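/- Let $k$ be an algebraically closed field of characteristic zero and let $X=\operatorname{Spec} R$ be a smooth affine algebraic variety over $k$ (in particular $R$ is a domain), of dimension $n$. For $m\ge 0$ let $X_m$ be the scheme of $m$-jets of $X$, which represents the functor $A\mapsto \operatorname{Hom}_{k\text{-alg}}(R,A[t]/(t^{m+1}))$ on $k$-algebras; let $X_\infty$ be the scheme of arcs of $X$, which represents $A\mapsto \operatorname{Hom}_{k\text{-alg}}(R,A[[t]])$; and let $\pi_m\colon X_\infty\to X_m$ be the truncation map. A subset of $X_\infty$ is called a *cylinder* if it is of the form $\pi_m^{-1}(S)$ for some $m\ge 0$ and some constructible subset $S\subseteq X_m$. For a closed irreducible subset $Z\subseteq X_\infty$, let $\operatorname{codim}(Z)$ be the Krull dimension of the local ring $\mathcal O_{X_\infty,Z}$ of $X_\infty$ at the generic point of $Z$, and let $$\operatorname{jetcodim}(Z):=\lim_{m\to\infty}\bigl((m+1)n-\dim\overline{\pi_m(Z)}\bigr).$$ For an arbitrary subset $C\subseteq X_\infty$, let $\operatorname{codim}(C)$ (respectively $\operatorname{jetcodim}(C)$) be the smallest value of $\operatorname{codim}(Z)$ (respectively $\operatorname{jetcodim}(Z)$)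 as $Z$ ranges over the irreducible components of the closure $\overline C$ (both are $\infty$ if $C=\emptyset$). Then the following hold. 1. For every subset $C\subseteq X_\infty$, one has $\operatorname{jetcodim}(C)=\operatorname{codim}(C)$. 2. For every closed irreducible subset $C\subseteq X_\infty$, the limit defining $\operatorname{jetcodim}(C)$ exists in $\mathbb Z\cup\{\infty\}$, and the common value $\operatorname{jetcodim}(C)=\operatorname{codim}(C)$ is finite if and only if $C$ is a cylinder. -/

import Mathlib

open Topology

noncomputable section

/-! ## Jet schemes and the scheme of arcs of an affine scheme

For a `k`-algebra `R` and `m : ℕ∞`, the algebra `JetAlgebra k R m` is the coordinate ring of the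
scheme of `m`-jets of `X = Spec R` when `m` is finite, and the coordinate ring of the scheme of
arcs of `X` when `m = ⊤`. It is generated by the coefficients `f⁽ⁱ⁾` (`f ∈ R`, `i ≤ m`) of the
universal jet (arc) `f ↦ ∑ i, f⁽ⁱ⁾ tⁱ`, with the relations saying that this is a homomorphism
of `k`-algebras. The universal properties are `JetAlgebra.existsUnique_of_arc`,
`JetAlgebra.exists_arc`, `JetAlgebra.existsUnique_of_jet` and `JetAlgebra.exists_jet`. -/

section JetAlgebra

variable (k : Type*) (R : Type*) [CommRing k] [CommRing R] [Algebra k R]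

/-- The defining relations of the jet algebra. The variable `X (i, f)` is the coefficient of `tⁱ`
in the image of `f` under the universal jet; variables of index larger than `m` are zero. -/
inductive JetRel (m : ℕ∞) : MvPolynomial (ℕ × R) k → Prop
  | trunc (i : ℕ) (hi : m < i) (f : R) : JetRel m (.X (i, f))
  | add (i : ℕ) (f g : R) : JetRel m (.X (i, f + g) - (.X (i, f) + .X (i, g)))
  | mul (i : ℕ) (hi : i ≤ m) (f g : R) : JetRel m
      (.X (i, f * g) - ∑ p ∈ Finset.HasAntidiagonal.antidiagonal i, .X (p.1, f) * .X (p.2, g))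
  | const_zero (c : k) : JetRel m (.X (0, algebraMap k R c) - .C c)
  | const_pos (i : ℕ) (hi : 0 < i) (c : k) : JetRel m (.X (i, algebraMap k R c))

/-- The coordinate ring of the scheme of `m`-jets (of arcs, if `m = ⊤`) of `Spec R`. -/
abbrev JetAlgebra (m : ℕ∞) : Type _ :=
  MvPolynomial (ℕ × R) k ⧸ Ideal.span {r | JetRel k R m r}

namespace JetAlgebra

variable {R}

/-- The coefficient `f⁽ⁱ⁾` of `tⁱ` in the image of `f` under the universal jet. -/
def coord (m : ℕ∞) (i : ℕ) (f : R) : JetAlgebra k R m :=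
  Ideal.Quotient.mk _ (.X (i, f))

variable {k} {A : Type*} [CommRing A] [Algebra k A]

/-- The homomorphism out of the jet algebra given by a higher derivation of length `m`. -/
def lift (m : ℕ∞) (D : ℕ → R → A)
    (htrunc : ∀ i : ℕ, m < i → ∀ f, D i f = 0)
    (hadd : ∀ i f g, D i (f + g) = D i f + D i g)
    (hmul : ∀ i : ℕ, i ≤ m → ∀ f g,
      D i (f * g) = ∑ p ∈ Finset.HasAntidiagonal.antidiagonal i, D p.1 f * D p.2 g)
    (hzero : ∀ c : k, D 0 (algebraMap k R c) = algebraMap k A c)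
    (hpos : ∀ i, 0 < i → ∀ c : k, D i (algebraMap k R c) = 0) :
    JetAlgebra k R m →ₐ[k] A :=
  Ideal.Quotient.liftₐ _ (MvPolynomial.aeval fun q : ℕ × R ↦ D q.1 q.2) <| by
    intro a ha
    refine (Ideal.span_le (I := RingHom.ker (MvPolynomial.aeval (R := k)
      fun q : ℕ × R ↦ D q.1 q.2))).2 ?_ ha
    rintro _ (⟨i, hi, f⟩ | ⟨i, f, g⟩ | ⟨i, hi, f, g⟩ | ⟨c⟩ | ⟨i, hi, c⟩)
    · simpa using htrunc i hi f
    · simpa using sub_eq_zero.2 (hadd i f g)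
    · simpa using sub_eq_zero.2 (hmul i hi f g)
    · simpa using sub_eq_zero.2 (hzero c)
    · simpa using hpos i hi c

theorem lift_coord (m : ℕ∞) (D : ℕ → R → A) (h₁ h₂ h₃ h₄ h₅) (i : ℕ) (f : R) :
    lift (k := k) m D h₁ h₂ h₃ h₄ h₅ (coord k m i f) = D i f :=
  (MvPolynomial.aeval_X (R := k) (fun q : ℕ × R ↦ D q.1 q.2) (i, f) :)

theorem hom_ext {m : ℕ∞} {φ ψ : JetAlgebra k R m →ₐ[k] A}
    (h : ∀ i f, φ (coord k m i f) = ψ (coord k m i f)) : φ = ψ := by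
  apply Ideal.Quotient.algHom_ext
  apply MvPolynomial.algHom_ext
  rintro ⟨i, f⟩
  exact h i f

theorem mk_eq_zero_of_rel {m : ℕ∞} {r : MvPolynomial (ℕ × R) k} (h : JetRel k R m r) :
    (Ideal.Quotient.mk _ r : JetAlgebra k R m) = 0 :=
  Ideal.Quotient.eq_zero_iff_mem.2 (Ideal.subset_span h)

theorem coord_trunc {m : ℕ∞} {i : ℕ} (hi : m < i) (f : R) : coord k m i f = 0 :=
  mk_eq_zero_of_rel (.trunc i hi f)

theorem coord_add (m : ℕ∞) (i : ℕ) (f g : R) :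
    coord k m i (f + g) = coord k m i f + coord k m i g := by
  simpa [coord, sub_eq_zero] using mk_eq_zero_of_rel (.add (k := k) (m := m) i f g)

theorem coord_mul {m : ℕ∞} {i : ℕ} (hi : i ≤ m) (f g : R) :
    coord k m i (f * g) =
      ∑ p ∈ Finset.HasAntidiagonal.antidiagonal i, coord k m p.1 f * coord k m p.2 g := by
  simpa [coord, sub_eq_zero] using mk_eq_zero_of_rel (.mul (k := k) i hi f g)

theorem coord_const_zero (m : ℕ∞) (c : k) :
    coord k m 0 (algebraMap k R c) = algebraMap k _ c := by
  have := mk_eq_zero_of_rel (.const_zero (k := k) (R := R) (m := m) c)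
  rw [map_sub, sub_eq_zero] at this
  exact this

theorem coord_const_pos (m : ℕ∞) {i : ℕ} (hi : 0 < i) (c : k) :
    coord k m i (algebraMap k R c) = 0 :=
  mk_eq_zero_of_rel (.const_pos i hi c)

variable (k R)

/-- The homomorphism of coordinate rings `O(X_m) → O(X_∞)` given by truncation of arcs. -/
def trunc (m : ℕ) : JetAlgebra k R m →ₐ[k] JetAlgebra k R ⊤ :=
  lift m (fun i f ↦ if i ≤ m then coord k ⊤ i f else 0)
    (fun i hi f ↦ if_neg (by exact_mod_cast not_le.2 hi))
    (fun i f g ↦ by split_ifs <;> simp [coord_add])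
    (fun i hi f g ↦ by
      have hi' : i ≤ m := by exact_mod_cast hi
      rw [if_pos hi', coord_mul le_top]
      refine Finset.sum_congr rfl fun p hp ↦ ?_
      have := Finset.HasAntidiagonal.mem_antidiagonal.1 hp
      rw [if_pos (by omega), if_pos (by omega)])
    (fun c ↦ by simp [coord_const_zero])
    (fun i hi c ↦ by split_ifs <;> simp [coord_const_pos, hi])

variable {R}

theorem trunc_coord (m i : ℕ) (f : R) :
    trunc k R m (coord k m i f) = if i ≤ m then coord k ⊤ i f else 0 :=
  lift_coord ..

variable {k}

/-- An arc `Spec A⟦t⟧ → Spec R` gives a unique `A`-valued point of the scheme of arcs. -/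
theorem existsUnique_of_arc (γ : R →ₐ[k] PowerSeries A) :
    ∃! φ : JetAlgebra k R ⊤ →ₐ[k] A,
      ∀ i f, φ (coord k ⊤ i f) = PowerSeries.coeff i (γ f) := by
  refine ⟨lift ⊤ (fun i f ↦ PowerSeries.coeff i (γ f)) (by simp) (by simp)
    (fun i _ f g ↦ by rw [map_mul, PowerSeries.coeff_mul]) (fun c ↦ ?_) (fun i hi c ↦ ?_),
    fun i f ↦ lift_coord .., fun ψ hψ ↦ hom_ext fun i f ↦ ?_⟩
  · simp [PowerSeries.algebraMap_apply]
  · simp [PowerSeries.algebraMap_apply, PowerSeries.coeff_C, hi.ne']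
  · rw [hψ, lift_coord]

/-- Every `A`-valued point of the scheme of arcs comes from an arc `Spec A⟦t⟧ → Spec R`. -/
theorem exists_arc (φ : JetAlgebra k R ⊤ →ₐ[k] A) :
    ∃ γ : R →ₐ[k] PowerSeries A,
      ∀ i f, φ (coord k ⊤ i f) = PowerSeries.coeff i (γ f) := by
  have hc : ∀ c : k, PowerSeries.mk (fun i ↦ φ (coord k ⊤ i (algebraMap k R c))) =
      algebraMap k _ c := by
    intro c
    ext i
    rcases Nat.eq_zero_or_pos i with rfl | hi
    · simp [coord_const_zero, PowerSeries.algebraMap_apply]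
    · simp [coord_const_pos ⊤ hi, PowerSeries.algebraMap_apply, PowerSeries.coeff_C, hi.ne']
  refine ⟨{ toFun := fun f ↦ PowerSeries.mk fun i ↦ φ (coord k ⊤ i f)
            map_one' := by simpa using hc 1
            map_mul' := fun f g ↦ ?_
            map_zero' := by simpa using hc 0
            map_add' := fun f g ↦ ?_
            commutes' := hc }, fun i f ↦ by simp⟩
  · ext i
    simp [PowerSeries.coeff_mul, coord_mul (le_top : (i : ℕ∞) ≤ ⊤)]
  · ext i
    simp [coord_add]

theorem mk_eq_mk_iff (m : ℕ) (p q : PowerSeries A) :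
    Ideal.Quotient.mk (Ideal.span {(PowerSeries.X : PowerSeries A) ^ (m + 1)}) p =
      Ideal.Quotient.mk _ q ↔ ∀ i ≤ m, PowerSeries.coeff i p = PowerSeries.coeff i q := by
  rw [Ideal.Quotient.eq, Ideal.mem_span_singleton, PowerSeries.X_pow_dvd_iff]
  simp [sub_eq_zero]

/-- An `m`-jet `Spec A[t]/(tᵐ⁺¹) → Spec R` gives a unique `A`-valued point of the scheme of
`m`-jets. -/
theorem existsUnique_of_jet (m : ℕ)
    (γ : R →ₐ[k] PowerSeries A ⧸ Ideal.span {(PowerSeries.X : PowerSeries A) ^ (m + 1)}) :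
    ∃! φ : JetAlgebra k R m →ₐ[k] A, ∀ f (p : PowerSeries A), γ f = Ideal.Quotient.mk _ p →
      ∀ i ≤ m, φ (coord k m i f) = PowerSeries.coeff i p := by
  choose P hP using fun f : R ↦ Ideal.Quotient.mk_surjective (γ f)
  have key : ∀ f (p : PowerSeries A), γ f = Ideal.Quotient.mk _ p → ∀ i ≤ m,
      PowerSeries.coeff i (P f) = PowerSeries.coeff i p := fun f p h ↦
    (mk_eq_mk_iff m _ _).1 ((hP f).trans h)
  refine ⟨lift m (fun i f ↦ if i ≤ m then PowerSeries.coeff i (P f) else 0)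
    (fun i hi f ↦ if_neg (by exact_mod_cast not_le.2 hi)) (fun i f g ↦ ?_)
    (fun i hi f g ↦ ?_) (fun c ↦ ?_) (fun i hi c ↦ ?_), fun f p hp i hi ↦ ?_,
    fun ψ hψ ↦ hom_ext fun i f ↦ ?_⟩
  · split_ifs with h
    · rw [key (f + g) (P f + P g) (by simp [hP]) i h, map_add]
    · simp
  · have h : i ≤ m := by exact_mod_cast hi
    rw [if_pos h, key (f * g) (P f * P g) (by simp [hP]) i h, PowerSeries.coeff_mul]
    refine Finset.sum_congr rfl fun p hp ↦ ?_
    have := Finset.HasAntidiagonal.mem_antidiagonal.1 hp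
    rw [if_pos (by omega), if_pos (by omega)]
  · rw [if_pos (Nat.zero_le _), key _ (algebraMap k _ c) (by rw [γ.commutes]; rfl) 0
      (Nat.zero_le _)]
    simp [PowerSeries.algebraMap_apply]
  · split_ifs with h
    · rw [key _ (algebraMap k _ c) (by rw [γ.commutes]; rfl) i h]
      simp [PowerSeries.algebraMap_apply, PowerSeries.coeff_C, hi.ne']
    · rfl
  · rw [lift_coord, if_pos hi, key f p hp i hi]
  · rw [lift_coord]
    split_ifs with h
    · exact hψ f (P f) (hP f).symm i h
    · rw [coord_trunc (by exact_mod_cast not_le.1 h), map_zero]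

/-- Every `A`-valued point of the scheme of `m`-jets comes from an `m`-jet. -/
theorem exists_jet (m : ℕ) (φ : JetAlgebra k R m →ₐ[k] A) :
    ∃ γ : R →ₐ[k] PowerSeries A ⧸ Ideal.span {(PowerSeries.X : PowerSeries A) ^ (m + 1)},
      ∀ f (p : PowerSeries A), γ f = Ideal.Quotient.mk _ p →
        ∀ i ≤ m, φ (coord k m i f) = PowerSeries.coeff i p := by
  have hc : ∀ c : k, Ideal.Quotient.mk
      (Ideal.span {(PowerSeries.X : PowerSeries A) ^ (m + 1)})
      (PowerSeries.mk fun i ↦ φ (coord k m i (algebraMap k R c))) =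
        algebraMap k _ c := by
    intro c
    change _ = Ideal.Quotient.mk _ (algebraMap k _ c)
    congr 1
    ext i
    rcases Nat.eq_zero_or_pos i with rfl | hi
    · simp [coord_const_zero, PowerSeries.algebraMap_apply]
    · simp [coord_const_pos m hi, PowerSeries.algebraMap_apply, PowerSeries.coeff_C, hi.ne']
  refine ⟨{ toFun := fun f ↦ Ideal.Quotient.mk _ (PowerSeries.mk fun i ↦ φ (coord k m i f))
            map_one' := by simpa using hc 1
            map_mul' := fun f g ↦ ?_
            map_zero' := by simpa using hc 0
            map_add' := fun f g ↦ ?_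
            commutes' := hc }, fun f p hp i hi ↦ ?_⟩
  · rw [← map_mul, mk_eq_mk_iff]
    intro i hi
    have hi' : (i : ℕ∞) ≤ m := by exact_mod_cast hi
    simp [PowerSeries.coeff_mul, coord_mul hi']
  · rw [← map_add]
    congr 1
    ext i
    simp [coord_add]
  · simpa using (mk_eq_mk_iff m _ _).1 hp i hi

end JetAlgebra

end JetAlgebra

/-! ## Krull codimension -/

section KrullCodim

/-- The set of irreducible components of a subset of a topological space. -/
def irredComponentsOf {T : Type*} [TopologicalSpace T] (F : Set T) : Set (Set T) :=
  {Z | Maximal (fun S ↦ IsIrreducible S ∧ S ⊆ F) Z}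

variable {B : Type*} [CommRing B]

/-- The Krull codimension of a closed irreducible subset `Z` of `Spec B`: the Krull dimension of
the local ring of `Spec B` at the generic point of `Z`. -/
def krullCodimIrred (Z : Set (PrimeSpectrum B)) (hZ : IsIrreducible Z) : WithBot ℕ∞ :=
  haveI := PrimeSpectrum.isIrreducible_iff_vanishingIdeal_isPrime.1 hZ
  ringKrullDim (Localization.AtPrime (PrimeSpectrum.vanishingIdeal Z))

/-- The Krull codimension of an arbitrary subset `C` of `Spec B`: the smallest Krull codimension
of an irreducible component of the closure of `C`. -/
def krullCodim (C : Set (PrimeSpectrum B)) : WithBot ℕ∞ :=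
  ⨅ (Z : Set (PrimeSpectrum B)) (hZ : Z ∈ irredComponentsOf (closure C)),
    krullCodimIrred Z hZ.1.1

end KrullCodim

/-! ## Jet-codimension and cylinders -/

section Arcs

variable (k : Type*) (R : Type*) [CommRing k] [CommRing R] [Algebra k R]

/-- The scheme of `m`-jets of `X = Spec R`, as a topological space. -/
abbrev JetSpace (m : ℕ) : Type _ := PrimeSpectrum (JetAlgebra k R m)

/-- The scheme of arcs of `X = Spec R`, as a topological space. -/
abbrev ArcSpace : Type _ := PrimeSpectrum (JetAlgebra k R ⊤)

/-- The canonical projection `π_m : X_∞ → X_m`. -/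
def arcProj (m : ℕ) : ArcSpace k R → JetSpace k R m :=
  PrimeSpectrum.comap (JetAlgebra.trunc k R m).toRingHom

/-- The inclusion of the possible values `-∞, 0, 1, 2, …, ∞` of a dimension in the extended real
numbers. -/
def dimToEReal : WithBot ℕ∞ → EReal :=
  WithBot.recBotCoe ⊥ fun d ↦ ((d : ENNReal) : EReal)

variable {k R}

/-- The number `(m + 1) n - dim (closure of π_m(C))`, where `n = dim X`. -/
def jetCodimSeq (C : Set (ArcSpace k R)) (m : ℕ) : EReal :=
  ((m + 1 : ℕ) : EReal) * dimToEReal (ringKrullDim R) -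
    dimToEReal (topologicalKrullDim (closure (arcProj k R m '' C)))

/-- The jet-codimension of a closed irreducible subset of `X_∞`: the limit of
`(m + 1) n - dim (closure of π_m(C))` as `m` tends to infinity. -/
def jetCodimIrred (C : Set (ArcSpace k R)) : EReal :=
  Filter.limUnder Filter.atTop (jetCodimSeq C)

/-- The jet-codimension of an arbitrary subset `C` of `X_∞`: the smallest jet-codimension of an
irreducible component of the closure of `C`. -/
def jetCodim (C : Set (ArcSpace k R)) : EReal :=
  ⨅ Z ∈ irredComponentsOf (closure C), jetCodimIrred Z

/-- A cylinder in `X_∞` is the inverse image under some `π_m` of a constructible subset of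
`X_m`. -/
def IsCylinder (C : Set (ArcSpace k R)) : Prop :=
  ∃ (m : ℕ) (S : Set (JetSpace k R m)), IsConstructible S ∧ C = arcProj k R m ⁻¹' S

end Arcs

end

noncomputable section

/-! ## Dimension theory of finitely generated domains over a field -/

section Dimension

/-! Let `C` be closed and irreducible with prime `p` in `O(X_∞)`, and let `p_m` be the contraction
of `p` to `O(X_m)`. The closure of `π_m(C)` is the zero locus of `p_m`, and `O(X_m)` is a finitely
generated domain of dimension `(m + 1) n`. The dimension formula therefore identifies the `m`-th
term of the sequence with the height of `p_m` (`jetCodimSeq_eq_height`), and it remains to compare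
these heights with that of `p`.

Smoothness enters through the maps `X_{m+1} → X_m`. Two lifts of a jet differ by a derivation, lifts
exist universally, and the differentials are projective. Hence `O(X_{m+1})` is a retract, over
`O(X_m)`, of a polynomial ring (`exists_mvPolynomial_retract`), and primes extend to primes lying
over them, also in the union `O(X_∞)` (`isPrime_map_trunc`). So the heights of the `p_m` increase
and are bounded by that of `p`. Conversely, a strict inclusion of primes of `O(X_∞)` is visible at
every sufficiently high finite level, so the height of `p` is the supremum, hence the limit
(`height_eq_iSup`).

If this height is finite, it is attained at some level `m`; then `p` is the extension of `p_m`, and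
`C` is the preimage of a closed set. If `C` is a cylinder over `X_m`, it contains the extension of
`p_m`, so this is `p`; finitely many generators and Krull's height theorem bound its height
(`isCylinder_iff_height_ne_top`). Arbitrary subsets reduce to the components of their closure.

The dimension of `X_m` is found by adding `n` elements to a transcendence basis at each level;
characteristic zero makes derivations of `R` correspond to their values on a transcendence basis. -/

/-- Going up lifts chains of primes, and incomparability keeps contracted chains strict. -/
theorem ringKrullDim_eq_of_isIntegral {A B : Type*} [CommRing A] [CommRing B] [Algebra A B]
    [Algebra.IsIntegral A B] (h : Function.Injective (algebraMap A B)) :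
    ringKrullDim A = ringKrullDim B := by
  apply le_antisymm
  · refine iSup_le fun l ↦ ?_
    obtain ⟨Q, -, hQ, hQl⟩ := Ideal.exists_ideal_over_prime_of_isIntegral (S := B)
      l.head.asIdeal ⊥ (by
        rw [← RingHom.ker_eq_comap_bot, (RingHom.injective_iff_ker_eq_bot _).1 h]; exact bot_le)
    have : Q.LiesOver l.head.asIdeal := ⟨hQl.symm⟩
    obtain ⟨L, hL, -⟩ := Ideal.exists_ltSeries_of_hasGoingUp l Q
    rw [← hL]
    exact le_iSup (fun L : LTSeries (PrimeSpectrum B) ↦ ((L.length : ℕ∞) : WithBot ℕ∞)) L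
  · exact Order.krullDim_le_of_strictMono (PrimeSpectrum.comap (algebraMap A B))
      fun _ _ hIJ ↦ Ideal.IsIntegral.comap_lt_comap hIJ

/-- Going down lifts a chain below the contraction to one ending at `P`; incomparability gives the
other inequality. -/
theorem Ideal.height_under_of_isIntegral {A B : Type*} [CommRing A] [CommRing B] [Algebra A B]
    [Algebra.IsIntegral A B] [Algebra.HasGoingDown A B] (P : Ideal B) [P.IsPrime] :
    (P.under A).height = P.height := by
  apply le_antisymm
  · refine (PrimeSpectrum.comap (algebraMap A B) ⟨P, ‹_›⟩).height_eq_orderHeight.trans_le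
      (le_of_le_of_eq ?_ (⟨P, ‹_›⟩ : PrimeSpectrum B).height_eq_orderHeight.symm)
    refine Order.height_le fun l hl ↦ ?_
    have : P.LiesOver l.last.asIdeal := ⟨by rw [hl]; rfl⟩
    obtain ⟨L, hL, hLP, -⟩ := Ideal.exists_ltSeries_of_hasGoingDown l P
    rw [← hL]
    exact Order.length_le_height hLP.le
  · refine (⟨P, ‹_›⟩ : PrimeSpectrum B).height_eq_orderHeight.trans_le
      (le_of_le_of_eq ?_ (PrimeSpectrum.comap (algebraMap A B) ⟨P, ‹_›⟩).height_eq_orderHeight.symm)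
    exact Order.height_le_height_apply_of_strictMono (PrimeSpectrum.comap (algebraMap A B))
      (fun _ _ hIJ ↦ Ideal.IsIntegral.comap_lt_comap hIJ) _

theorem Ideal.height_add_ringKrullDim_quotient_le {A : Type*} [CommRing A] (p : Ideal A)
    [p.IsPrime] : p.height + ringKrullDim (A ⧸ p) ≤ ringKrullDim A := by
  let x : PrimeSpectrum A := ⟨p, ‹_›⟩
  have h : (p.height : WithBot ℕ∞) = (Order.height x : ℕ∞) := by
    rw [← x.height_eq_orderHeight]
  have h' : ringKrullDim (A ⧸ p) = (Order.coheight x : ℕ∞) := by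
    rw [ringKrullDim_quotient, Order.coheight_eq_krullDim_Ici]
    rfl
  have : Nonempty (PrimeSpectrum A) := ⟨x⟩
  rw [h, h', ringKrullDim, Order.krullDim_eq_iSup_height_add_coheight_of_nonempty]
  exact_mod_cast le_iSup (fun y : PrimeSpectrum A ↦ Order.height y + Order.coheight y) x

/-- A maximal chain below `p / I` pulls back to primes containing `I ≠ ⊥`, so the zero ideal can be
put in front of it. -/
theorem Ideal.height_map_quotientMk_add_one_le {A : Type*} [CommRing A] [IsNoetherianRing A]
    [IsDomain A] {I p : Ideal A} (hI : I ≠ ⊥) (hIp : I ≤ p) [p.IsPrime] :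
    (p.map (Ideal.Quotient.mk I)).height + 1 ≤ p.height := by
  have hP : (p.map (Ideal.Quotient.mk I)).IsPrime := Ideal.isPrime_map_quotientMk_of_isPrime hIp
  obtain ⟨l, hl, hlen⟩ := (p.map (Ideal.Quotient.mk I)).exists_ltSeries_length_eq_height
  let l' := l.map (PrimeSpectrum.comap (Ideal.Quotient.mk I))
    (RingHom.strictMono_comap_of_surjective Ideal.Quotient.mk_surjective)
  have hlast : l'.last = ⟨p, ‹_›⟩ := by
    ext1
    simp only [l', LTSeries.last_map, hl, PrimeSpectrum.comap_asIdeal]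
    rw [Ideal.comap_map_of_surjective _ Ideal.Quotient.mk_surjective, ← RingHom.ker_eq_comap_bot,
      Ideal.mk_ker, sup_eq_left.2 hIp]
  have hbot : (⊥ : PrimeSpectrum A) < l'.head := by
    refine bot_lt_iff_ne_bot.2 fun h ↦ hI (le_bot_iff.1 ?_)
    have h1 : I ≤ l'.head.asIdeal := by
      rw [← Ideal.mk_ker (I := I)]
      exact Ideal.comap_mono bot_le
    rwa [h] at h1
  refine le_of_le_of_eq ?_ (⟨p, ‹_›⟩ : PrimeSpectrum A).height_eq_orderHeight.symm
  have := Order.length_le_height (p := l'.cons ⊥ hbot) (x := ⟨p, ‹_›⟩) (by simp [hlast])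
  rw [← hlen]
  simpa [l'] using this

/-- Polynomial rings over a field are Jacobson, so a maximal ideal contracts to a maximal ideal in
one variable fewer, and each variable adds one to the height. -/
theorem MvPolynomial.height_eq_of_isMaximal {k : Type*} [Field k] (n : ℕ)
    (M : Ideal (MvPolynomial (Fin n) k)) [M.IsMaximal] : M.height = n := by
  induction n with
  | zero =>
    have : ringKrullDim (MvPolynomial (Fin 0) k) = 0 := by simp
    have h : (M.height : WithBot ℕ∞) ≤ 0 := this ▸ Ideal.height_le_ringKrullDim_of_isPrime
    simpa using h
  | succ n ih =>
    let e := (MvPolynomial.finSuccEquiv k n).toRingEquiv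
    let M' := M.map e
    have : M'.IsMaximal := Ideal.map_isMaximal_of_equiv e
    have hM : M.height = M'.height := (e.height_map M).symm
    have : (M'.under (MvPolynomial (Fin n) k)).IsMaximal :=
      Polynomial.isMaximal_comap_C_of_isJacobsonRing M'
    have : M'.LiesOver (M'.under (MvPolynomial (Fin n) k)) := ⟨rfl⟩
    rw [hM, Polynomial.height_eq_height_add_one (M'.under _) M', ih]
    simp

variable {k : Type*} [Field k]

/-- The dimension formula for a ring that is finite over a polynomial ring follows from the
dimension formula for that polynomial ring. -/
theorem height_add_ringKrullDim_quotient_of_mvPolynomial {B : Type*} [CommRing B] [IsDomain B]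
    (s : ℕ) (g : MvPolynomial (Fin s) k →+* B) (hg : Function.Injective g) (hgi : g.IsIntegral)
    (H : ∀ p : Ideal (MvPolynomial (Fin s) k), p.IsPrime →
      p.height + ringKrullDim (MvPolynomial (Fin s) k ⧸ p) = s)
    (P : Ideal B) [P.IsPrime] : P.height + ringKrullDim (B ⧸ P) = s := by
  let _ := g.toAlgebra
  have : Algebra.IsIntegral (MvPolynomial (Fin s) k) B := ⟨hgi⟩
  have : FaithfulSMul (MvPolynomial (Fin s) k) B := (faithfulSMul_iff_algebraMap_injective _ _).2 hg
  -- Going down is available because the polynomial ring is a normal domain.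
  rw [← Ideal.height_under_of_isIntegral (A := MvPolynomial (Fin s) k) P,
    ← ringKrullDim_eq_of_isIntegral (A := MvPolynomial (Fin s) k ⧸ P.under _) (B := B ⧸ P)
      Ideal.algebraMap_quotient_injective, H _ inferInstance]

/-- For the nontrivial inequality, cut by a prime element `f ∈ p`. The hypersurface is integral over
a polynomial ring in `s - 1` variables by Noether normalization, where induction applies, and
lifting back from it raises the height of `p` by at least one. -/
theorem MvPolynomial.height_add_ringKrullDim_quotient (s : ℕ)
    (p : Ideal (MvPolynomial (Fin s) k)) [hp : p.IsPrime] :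
    p.height + ringKrullDim (MvPolynomial (Fin s) k ⧸ p) = s := by
  induction s using Nat.strong_induction_on with | _ s ih
  have hdim : ringKrullDim (MvPolynomial (Fin s) k) = s := by simp
  apply le_antisymm
  · exact hdim ▸ p.height_add_ringKrullDim_quotient_le
  by_cases hp0 : p = ⊥
  · subst hp0
    rw [Ideal.height_bot, ringKrullDim_eq_of_ringEquiv (RingEquiv.quotientBot (MvPolynomial (Fin s) k))]
    simp
  obtain ⟨f, hfp, hf⟩ := hp.exists_mem_prime_of_ne_bot hp0
  let I := Ideal.span {f}
  have hI : I.IsPrime := (Ideal.span_singleton_prime hf.ne_zero).2 hf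
  have hIp : I ≤ p := (Ideal.span_singleton_le_iff_mem p).2 hfp
  obtain ⟨d, g, hg, hgf⟩ := exists_integral_inj_algHom_of_fg k (MvPolynomial (Fin s) k ⧸ I)
  have hd : ringKrullDim (MvPolynomial (Fin s) k ⧸ I) = d := by
    let _ := g.toRingHom.toAlgebra
    have : Algebra.IsIntegral (MvPolynomial (Fin d) k) (MvPolynomial (Fin s) k ⧸ I) := ⟨hgf⟩
    rw [← ringKrullDim_eq_of_isIntegral (A := MvPolynomial (Fin d) k) hg]
    simp
  have hd1 : d + 1 ≤ s := by
    have := ringKrullDim_quotient_succ_le_of_nonZeroDivisor (mem_nonZeroDivisors_of_ne_zero hf.ne_zero)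
    rw [hd, hdim] at this
    exact_mod_cast this
  -- A maximal ideal above `p` has height `s`, and cutting by the single element `f` lowers this by
  -- at most one.
  have hs : s ≤ d + 1 := by
    obtain ⟨M, hM, hpM⟩ := p.exists_le_maximal hp.ne_top
    have := Ideal.height_le_ringKrullDim_quotient_add_one (hpM hfp)
    rw [hd, MvPolynomial.height_eq_of_isMaximal] at this
    exact_mod_cast this
  obtain rfl : s = d + 1 := le_antisymm hs hd1
  let P := p.map (Ideal.Quotient.mk I)
  have hP : P.IsPrime := Ideal.isPrime_map_quotientMk_of_isPrime hIp
  have key := height_add_ringKrullDim_quotient_of_mvPolynomial d g.toRingHom hg hgf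
    (fun q hq ↦ ih d (by omega) q) P
  have hh : P.height + 1 ≤ p.height :=
    Ideal.height_map_quotientMk_add_one_le (by simpa [I] using hf.ne_zero) hIp
  rw [ringKrullDim_eq_of_ringEquiv (DoubleQuot.quotQuotEquivQuotOfLE hIp)] at key
  push_cast
  rw [← key, add_right_comm]
  gcongr
  exact_mod_cast hh

/-- The dimension formula for finitely generated domains over a field. -/
theorem height_add_ringKrullDim_quotient (k : Type*) [Field k] {B : Type*} [CommRing B]
    [IsDomain B] [Algebra k B] [Algebra.FiniteType k B] (P : Ideal B) [P.IsPrime] :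
    P.height + ringKrullDim (B ⧸ P) = ringKrullDim B := by
  obtain ⟨s, g, hg, hgi⟩ := exists_integral_inj_algHom_of_fg k B
  rw [height_add_ringKrullDim_quotient_of_mvPolynomial s g.toRingHom hg hgi
    (fun p hp ↦ MvPolynomial.height_add_ringKrullDim_quotient s p)]
  let _ := g.toRingHom.toAlgebra
  have : Algebra.IsIntegral (MvPolynomial (Fin s) k) B := ⟨hgi⟩
  rw [← ringKrullDim_eq_of_isIntegral (A := MvPolynomial (Fin s) k) hg]
  simp

/-- A finitely generated domain over a field is algebraic over a polynomial subring in as many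
variables as its dimension. -/
theorem exists_isTranscendenceBasis_fin (k : Type*) [Field k] (B : Type*) [CommRing B]
    [IsDomain B] [Algebra k B] [Algebra.FiniteType k B] :
    ∃ (s : ℕ) (x : Fin s → B), IsTranscendenceBasis k x ∧ ringKrullDim B = s := by
  obtain ⟨s, g, hg, hgi⟩ := exists_integral_inj_algHom_of_fg k B
  let _ := g.toRingHom.toAlgebra
  have : Algebra.IsIntegral (MvPolynomial (Fin s) k) B := ⟨hgi⟩
  have : IsScalarTower k (MvPolynomial (Fin s) k) B := .of_algebraMap_eq fun x ↦ (g.commutes x).symm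
  have : FaithfulSMul (MvPolynomial (Fin s) k) B := (faithfulSMul_iff_algebraMap_injective _ _).2 hg
  refine ⟨s, _, (IsTranscendenceBasis.mvPolynomial (Fin s) k).algebraMap_comp (A := B), ?_⟩
  rw [← ringKrullDim_eq_of_isIntegral (A := MvPolynomial (Fin s) k) hg]
  simp

theorem ringKrullDim_eq_card_of_isTranscendenceBasis {B : Type*} [CommRing B]
    [IsDomain B] [Algebra k B] [Algebra.FiniteType k B] {ι : Type*} [Finite ι] {x : ι → B}
    (hx : IsTranscendenceBasis k x) : ringKrullDim B = Nat.card ι := by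
  obtain ⟨s, y, hy, hs⟩ := exists_isTranscendenceBasis_fin k B
  have := congrArg Cardinal.toNat (hx.lift_cardinalMk_eq hy)
  simp only [Cardinal.toNat_lift] at this
  rw [hs, Nat.card, this]
  simp

end Dimension

/-! ## Truncation and generation of jet algebras -/

/-- The ring of power series is complete with respect to the powers of `X`. -/
theorem PowerSeries.isAdicComplete_span_X_pow (A : Type*) [CommRing A] (d : ℕ) (hd : d ≠ 0) :
    IsAdicComplete (Ideal.span {(PowerSeries.X : PowerSeries A) ^ d}) (PowerSeries A) := by
  have hmem (n : ℕ) (x y : PowerSeries A) :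
      x ≡ y [SMOD (Ideal.span {(PowerSeries.X : PowerSeries A) ^ d} ^ n • ⊤ :
        Submodule (PowerSeries A) (PowerSeries A))] ↔
      ∀ i < d * n, PowerSeries.coeff i x = PowerSeries.coeff i y := by
    rw [SModEq.sub_mem, smul_eq_mul, Ideal.mul_top, Ideal.span_singleton_pow,
      Ideal.mem_span_singleton, ← pow_mul, PowerSeries.X_pow_dvd_iff]
    simp [sub_eq_zero]
  have hlt (i : ℕ) : i < d * (i + 1) := Nat.lt_of_lt_of_le (Nat.lt_succ_self i)
    (Nat.le_mul_of_pos_left _ (Nat.pos_of_ne_zero hd))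
  refine { haus' := fun x hx ↦ ?_, prec' := fun f hf ↦ ?_ }
  · ext i
    exact (hmem (i + 1) x 0).1 (hx _) i (hlt i)
  -- The `i`-th coefficient is stable from the term `f (i + 1)` on, since `i < d * (i + 1)`.
  · refine ⟨PowerSeries.mk fun i ↦ PowerSeries.coeff i (f (i + 1)), fun n ↦ ?_⟩
    rw [hmem]
    intro i hi
    rw [PowerSeries.coeff_mk]
    rcases le_total n (i + 1) with h | h
    · exact (hmem _ _ _).1 (hf h) i hi
    · exact ((hmem _ _ _).1 (hf h) i (hlt i)).symm

namespace JetAlgebra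

section Transit

variable (k R : Type*) [CommRing k] [CommRing R] [Algebra k R]

/-- The homomorphism of coordinate rings given by the truncation of `b`-jets to `a`-jets. -/
def transit {a b : ℕ∞} (hab : a ≤ b) : JetAlgebra k R a →ₐ[k] JetAlgebra k R b :=
  open Classical in
  lift a (fun i f ↦ if (i : ℕ∞) ≤ a then coord k b i f else 0)
    (fun i hi f ↦ if_neg (not_le.2 hi))
    (fun i f g ↦ by split_ifs <;> simp [coord_add])
    (fun i hi f g ↦ by
      rw [if_pos hi, coord_mul (hi.trans hab)]
      refine Finset.sum_congr rfl fun p hp ↦ ?_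
      have h := Finset.HasAntidiagonal.mem_antidiagonal.1 hp
      have h1 : (p.1 : ℕ∞) ≤ a := le_trans (by exact_mod_cast (by omega)) hi
      have h2 : (p.2 : ℕ∞) ≤ a := le_trans (by exact_mod_cast (by omega)) hi
      rw [if_pos h1, if_pos h2])
    (fun c ↦ by simp [coord_const_zero])
    (fun i hi c ↦ by split_ifs <;> simp [coord_const_pos, hi])

variable {k R}

theorem transit_coord {a b : ℕ∞} (hab : a ≤ b) {i : ℕ} (hi : i ≤ a) (f : R) :
    transit k R hab (coord k a i f) = coord k b i f :=
  (lift_coord ..).trans (if_pos hi)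

theorem hom_ext_of_le {A : Type*} [CommRing A] [Algebra k A] {a : ℕ∞}
    {φ ψ : JetAlgebra k R a →ₐ[k] A}
    (h : ∀ i : ℕ, i ≤ a → ∀ f, φ (coord k a i f) = ψ (coord k a i f)) : φ = ψ := by
  refine hom_ext fun i f ↦ ?_
  by_cases hi : (i : ℕ∞) ≤ a
  · exact h i hi f
  · rw [coord_trunc (not_le.1 hi), map_zero, map_zero]

theorem transit_comp {a b c : ℕ∞} (hab : a ≤ b) (hbc : b ≤ c) :
    (transit k R hbc).comp (transit k R hab) = transit k R (hab.trans hbc) :=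
  hom_ext_of_le fun i hi f ↦ by
    simp [transit_coord, hi, hi.trans hab]

theorem transit_transit {a b c : ℕ∞} (hab : a ≤ b) (hbc : b ≤ c) (z : JetAlgebra k R a) :
    transit k R hbc (transit k R hab z) = transit k R (hab.trans hbc) z :=
  DFunLike.congr_fun (transit_comp hab hbc) z

theorem transit_self {a : ℕ∞} (z : JetAlgebra k R a) : transit k R le_rfl z = z :=
  DFunLike.congr_fun (hom_ext_of_le fun _ hi f ↦ transit_coord _ hi f :
    transit k R (le_refl a) = AlgHom.id k _) z

theorem trunc_eq_transit (m : ℕ) : trunc k R m = transit k R le_top :=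
  hom_ext_of_le fun i hi f ↦ by
    rw [transit_coord _ hi, trunc_coord, if_pos (by exact_mod_cast hi)]

variable (k R)

theorem adjoin_range_coord (a : ℕ∞) :
    Algebra.adjoin k (Set.range fun q : ℕ × R ↦ coord k a q.1 q.2) = ⊤ := by
  rw [eq_top_iff]
  rintro z -
  obtain ⟨p, rfl⟩ := Ideal.Quotient.mk_surjective z
  induction p using MvPolynomial.induction_on with
  | C c => exact Subalgebra.algebraMap_mem _ c
  | add p q hp hq => rw [map_add]; exact add_mem hp hq
  | mul_X p q hp => rw [map_mul]; exact mul_mem hp (Algebra.subset_adjoin ⟨q, rfl⟩)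

variable {k R}

theorem eq_top_of_coord_mem {a : ℕ∞} (S : Subalgebra k (JetAlgebra k R a))
    (h : ∀ i : ℕ, i ≤ a → ∀ f, coord k a i f ∈ S) : S = ⊤ := by
  rw [eq_top_iff, ← adjoin_range_coord k R, Algebra.adjoin_le_iff]
  rintro _ ⟨⟨i, f⟩, rfl⟩
  by_cases hi : (i : ℕ∞) ≤ a
  · exact h i hi f
  · change coord k a i f ∈ S
    rw [coord_trunc (not_le.1 hi)]
    exact S.zero_mem

/-- Every function on the scheme of arcs comes from a scheme of jets. -/
theorem exists_trunc_eq (z : JetAlgebra k R ⊤) (m₀ : ℕ) : ∃ m ≥ m₀, ∃ y, trunc k R m y = z := by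
  suffices h : ∃ m, ∃ y, trunc k R m y = z by
    obtain ⟨m, y, rfl⟩ := h
    refine ⟨max m m₀, le_max_right _ _,
      transit k R (by exact_mod_cast le_max_left m m₀) y, ?_⟩
    rw [trunc_eq_transit, trunc_eq_transit, transit_transit]
  have hz : z ∈ Algebra.adjoin k (Set.range fun q : ℕ × R ↦ coord k ⊤ q.1 q.2) := by
    rw [adjoin_range_coord]; trivial
  -- Sums and products are formed after moving both functions to a common level.
  have key (m n : ℕ) (x : JetAlgebra k R m) (y : JetAlgebra k R n) :
      ∃ (l : ℕ) (x' y' : JetAlgebra k R l),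
        trunc k R m x = trunc k R l x' ∧ trunc k R n y = trunc k R l y' :=
    ⟨max m n, transit k R (by exact_mod_cast le_max_left m n) x,
      transit k R (by exact_mod_cast le_max_right m n) y, by
        simp only [trunc_eq_transit, transit_transit, and_self]⟩
  induction hz using Algebra.adjoin_induction with
  | mem z hz =>
    obtain ⟨⟨i, f⟩, rfl⟩ := hz
    exact ⟨i, coord k i i f, by rw [trunc_coord, if_pos le_rfl]⟩
  | algebraMap c => exact ⟨0, algebraMap k _ c, AlgHom.commutes _ _⟩
  | add x y _ _ hx hy =>
    obtain ⟨m, x, rfl⟩ := hx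
    obtain ⟨n, y, rfl⟩ := hy
    obtain ⟨l, x', y', hx, hy⟩ := key m n x y
    exact ⟨l, x' + y', by rw [map_add, hx, hy]⟩
  | mul x y _ _ hx hy =>
    obtain ⟨m, x, rfl⟩ := hx
    obtain ⟨n, y, rfl⟩ := hy
    obtain ⟨l, x', y', hx, hy⟩ := key m n x y
    exact ⟨l, x' * y', by rw [map_mul, hx, hy]⟩

/-- By the product rule, the coefficients of order at most `m` of finitely many generators of `R`
suffice. -/
instance finiteType [Algebra.FiniteType k R] (m : ℕ) : Algebra.FiniteType k (JetAlgebra k R m) := by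
  obtain ⟨s, hs⟩ := Algebra.FiniteType.out (R := k) (A := R)
  have hfin : ((fun q : ℕ × R ↦ coord k m q.1 q.2) '' (Set.Iic m ×ˢ (s : Set R))).Finite :=
    ((Set.finite_Iic m).prod s.finite_toSet).image _
  refine ⟨⟨hfin.toFinset, ?_⟩⟩
  rw [Set.Finite.coe_toFinset]
  set S := Algebra.adjoin k ((fun q : ℕ × R ↦ coord k m q.1 q.2) '' (Set.Iic m ×ˢ (s : Set R)))
  refine eq_top_of_coord_mem _ fun i hi f ↦ ?_
  have hf : f ∈ Algebra.adjoin k (s : Set R) := hs ▸ Algebra.mem_top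
  replace hi : i ≤ m := by exact_mod_cast hi
  induction hf using Algebra.adjoin_induction generalizing i with
  | mem f hf => exact Algebra.subset_adjoin ⟨(i, f), ⟨hi, hf⟩, rfl⟩
  | algebraMap c =>
    rcases Nat.eq_zero_or_pos i with rfl | h
    · rw [coord_const_zero]; exact S.algebraMap_mem c
    · rw [coord_const_pos _ h]; exact S.zero_mem
  | add x y _ _ hx hy => rw [coord_add]; exact add_mem (hx i hi) (hy i hi)
  | mul x y _ _ hx hy =>
    rw [coord_mul (by exact_mod_cast hi)]
    refine sum_mem fun p hp ↦ ?_
    have h := Finset.HasAntidiagonal.mem_antidiagonal.1 hp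
    exact mul_mem (hx _ (by omega)) (hy _ (by omega))

theorem coord_smul (a : ℕ∞) (i : ℕ) (c : k) (f : R) :
    coord k a i (c • f) = c • coord k a i f := by
  by_cases hi : (i : ℕ∞) ≤ a
  · rw [Algebra.smul_def, coord_mul hi, Finset.sum_eq_single (0, i), coord_const_zero]
    · exact (Algebra.smul_def c _).symm
    · intro p hp hne
      have := Finset.HasAntidiagonal.mem_antidiagonal.1 hp
      rw [coord_const_pos, zero_mul]
      exact Nat.pos_of_ne_zero fun h ↦ hne (Prod.ext h (by simp; omega))
    · simp
  · rw [coord_trunc (not_le.1 hi), coord_trunc (not_le.1 hi), smul_zero]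

variable (k R)

/-- The constant term of the universal jet. -/
def base (a : ℕ∞) : R →ₐ[k] JetAlgebra k R a where
  toFun := coord k a 0
  map_one' := by simpa using coord_const_zero (R := R) a (1 : k)
  map_mul' f g := by simp [coord_mul (zero_le : ((0 : ℕ) : ℕ∞) ≤ a)]
  map_zero' := by simpa using coord_const_zero (R := R) a (0 : k)
  map_add' := coord_add a 0
  commutes' := coord_const_zero a

/-- The scheme of `0`-jets of `Spec R` is `Spec R`. -/
def baseEquiv : R ≃ₐ[k] JetAlgebra k R (0 : ℕ) :=
  AlgEquiv.ofAlgHom (base k R (0 : ℕ))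
    (lift (0 : ℕ) (fun i f ↦ if i = 0 then f else 0)
      (fun i hi f ↦ if_neg (by rintro rfl; simp at hi))
      (fun i f g ↦ by split_ifs <;> simp)
      (fun i hi f g ↦ by
        obtain rfl : i = 0 := by simpa using hi
        simp)
      (fun c ↦ by simp)
      (fun i hi c ↦ if_neg hi.ne'))
    (hom_ext_of_le fun i hi f ↦ by
      obtain rfl : i = 0 := by simpa using hi
      simp only [AlgHom.comp_apply, lift_coord]
      rfl)
    (AlgHom.ext fun f ↦ by
      simp only [AlgHom.comp_apply, AlgHom.id_apply]
      exact (lift_coord ..).trans (if_pos rfl))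

/-- A jet of a smooth affine scheme extends to an arc, functorially. -/
theorem exists_trunc_retraction [Algebra.FormallySmooth k R] (m : ℕ) :
    ∃ r : JetAlgebra k R ⊤ →ₐ[k] JetAlgebra k R m, ∀ z, r (trunc k R m z) = z := by
  -- The identity corresponds to the universal `m`-jet; smoothness and completeness of the power
  -- series ring lift it to an arc.
  obtain ⟨γ, hγ⟩ := exists_jet m (AlgHom.id k (JetAlgebra k R m))
  have := PowerSeries.isAdicComplete_span_X_pow (JetAlgebra k R m) (m + 1) (Nat.succ_ne_zero m)
  obtain ⟨g, hg⟩ := Algebra.FormallySmooth.exists_mkₐ_comp_eq_of_isAdicComplete γ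
  obtain ⟨r, hr, -⟩ := existsUnique_of_arc g
  refine ⟨r, fun z ↦ DFunLike.congr_fun (hom_ext_of_le fun i hi f ↦ ?_ :
    r.comp (trunc k R m) = AlgHom.id k _) z⟩
  have hi' : i ≤ m := by exact_mod_cast hi
  rw [AlgHom.comp_apply, trunc_coord, if_pos hi', hr]
  exact (hγ f (g f) (DFunLike.congr_fun hg f).symm i hi').symm

end Transit

end JetAlgebra

/-! ### Convolution sums with a correction in the top degree -/

theorem sum_antidiagonal_ite_fst {A : Type*} [CommRing A] (n : ℕ) (a : A) (F : ℕ → A) :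
    ∑ p ∈ Finset.HasAntidiagonal.antidiagonal n, (if p.1 = n then a else 0) * F p.2 =
      a * F 0 := by
  rw [Finset.sum_eq_single (n, 0)]
  · simp
  · intro p hp hne
    have := Finset.HasAntidiagonal.mem_antidiagonal.1 hp
    rw [if_neg, zero_mul]
    exact fun h ↦ hne (Prod.ext h (by simp; omega))
  · simp

theorem sum_antidiagonal_ite_snd {A : Type*} [CommRing A] (n : ℕ) (a : A) (F : ℕ → A) :
    ∑ p ∈ Finset.HasAntidiagonal.antidiagonal n, F p.1 * (if p.2 = n then a else 0) =
      F 0 * a := by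
  rw [Finset.sum_eq_single (0, n)]
  · simp
  · intro p hp hne
    have := Finset.HasAntidiagonal.mem_antidiagonal.1 hp
    rw [if_neg, mul_zero]
    exact fun h ↦ hne (Prod.ext (by simp; omega) h)
  · simp

theorem sum_antidiagonal_ite_ite {A : Type*} [CommRing A] (n : ℕ) (hn : n ≠ 0) (a b : A) :
    ∑ p ∈ Finset.HasAntidiagonal.antidiagonal n,
      (if p.1 = n then a else 0) * (if p.2 = n then b else 0) = 0 := by
  refine Finset.sum_eq_zero fun p hp ↦ ?_
  have := Finset.HasAntidiagonal.mem_antidiagonal.1 hp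
  split_ifs
  · omega
  all_goals simp

namespace JetAlgebra

/-! ## Jets of order `m + 1` over jets of order `m` -/

section Step

variable {k R : Type*} [CommRing k] [CommRing R] [Algebra k R] {m : ℕ}
  {A : Type*} [CommRing A] [Algebra k A] [Algebra R A]

/-- Adding a derivation to the top coefficient of an `(m + 1)`-jet gives an `(m + 1)`-jet. -/
theorem exists_add_derivation (φ : JetAlgebra k R (m + 1 : ℕ) →ₐ[k] A)
    (h : ∀ f, φ (coord k _ 0 f) = algebraMap R A f) (d : Derivation k R A) :
    ∃ ψ : JetAlgebra k R (m + 1 : ℕ) →ₐ[k] A,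
      (∀ i ≤ m, ∀ f, ψ (coord k _ i f) = φ (coord k _ i f)) ∧
      ∀ f, ψ (coord k _ (m + 1) f) = φ (coord k _ (m + 1) f) + d f := by
  have hd (c : k) : d (algebraMap k R c) = 0 := d.map_algebraMap c
  refine ⟨lift _ (fun i f ↦ φ (coord k _ i f) + if i = m + 1 then d f else 0)
    (fun i hi f ↦ ?_) (fun i f g ↦ ?_) (fun i hi f g ↦ ?_) (fun c ↦ ?_) (fun i hi c ↦ ?_),
    fun i hi f ↦ ?_, fun f ↦ ?_⟩
  · rw [coord_trunc hi, if_neg, map_zero, zero_add]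
    rintro rfl
    exact lt_irrefl _ hi
  · rw [coord_add, map_add]
    split_ifs
    · rw [map_add]; abel
    · abel
  · rw [coord_mul hi, map_sum]
    simp only [map_mul]
    split_ifs with hm
    · subst hm
      -- The product of the two corrections has too high an order; the linear terms meet only the
      -- constant coefficients and give the Leibniz rule for `d`.
      have hz := sum_antidiagonal_ite_ite (m + 1) m.succ_ne_zero (d f) (d g)
      have h1 := sum_antidiagonal_ite_fst (m + 1) (d f) fun i ↦ φ (coord k (m + 1 : ℕ) i g)
      have h2 := sum_antidiagonal_ite_snd (m + 1) (d g) fun i ↦ φ (coord k (m + 1 : ℕ) i f)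
      rw [h] at h1 h2
      simp only [add_mul, mul_add, Finset.sum_add_distrib, h1, h2, hz]
      rw [d.leibniz, Algebra.smul_def, Algebra.smul_def]
      ring
    · rw [add_zero]
      refine Finset.sum_congr rfl fun p hp ↦ ?_
      have := Finset.HasAntidiagonal.mem_antidiagonal.1 hp
      have hi' : i ≤ m + 1 := by exact_mod_cast hi
      rw [if_neg (by omega), if_neg (by omega), add_zero, add_zero]
  · simp [coord_const_zero]
  · simp [coord_const_pos, hi, hd]
  · rw [lift_coord, if_neg (by omega), add_zero]
  · rw [lift_coord, if_pos rfl]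

/-- The difference of the top coefficients of two `(m + 1)`-jets with the same truncation to an
`m`-jet is a derivation. -/
theorem exists_sub_derivation (φ ψ : JetAlgebra k R (m + 1 : ℕ) →ₐ[k] A)
    (h : ∀ f, φ (coord k _ 0 f) = algebraMap R A f)
    (hφψ : ∀ i ≤ m, ∀ f, ψ (coord k _ i f) = φ (coord k _ i f)) :
    ∃ d : Derivation k R A,
      ∀ f, d f = ψ (coord k _ (m + 1) f) - φ (coord k _ (m + 1) f) := by
  -- Viewing `ψ` as `φ` plus a top-degree correction lets the convolution identities yield the
  -- Leibniz rule for the difference.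
  have hw (i : ℕ) (hi : i ≤ m + 1) (f : R) : ψ (coord k _ i f) = φ (coord k _ i f) +
      if i = m + 1 then ψ (coord k _ (m + 1) f) - φ (coord k _ (m + 1) f) else 0 := by
    split_ifs with h'
    · subst h'; ring
    · rw [hφψ i (by omega), add_zero]
  refine ⟨Derivation.mk' { toFun f := ψ (coord k _ (m + 1) f) - φ (coord k _ (m + 1) f)
                           map_add' f g := ?_
                           map_smul' c f := ?_ } fun f g ↦ ?_, fun f ↦ rfl⟩
  · simp only [coord_add, map_add]; ring
  · simp only [coord_smul, map_smul, smul_sub, RingHom.id_apply]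
  · change ψ (coord k _ (m + 1) (f * g)) - φ (coord k _ (m + 1) (f * g)) =
      f • (ψ (coord k _ (m + 1) g) - φ (coord k _ (m + 1) g)) +
      g • (ψ (coord k _ (m + 1) f) - φ (coord k _ (m + 1) f))
    rw [coord_mul le_rfl, map_sum, map_sum]
    simp only [map_mul]
    rw [Finset.sum_congr rfl fun p hp ↦ congrArg₂ (· * ·)
      (hw p.1 (by have := Finset.HasAntidiagonal.mem_antidiagonal.1 hp; omega) f)
      (hw p.2 (by have := Finset.HasAntidiagonal.mem_antidiagonal.1 hp; omega) g)]
    generalize ψ (coord k _ (m + 1) f) - φ (coord k _ (m + 1) f) = u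
    generalize ψ (coord k _ (m + 1) g) - φ (coord k _ (m + 1) g) = v
    have h1 := sum_antidiagonal_ite_fst (m + 1) u fun i ↦ φ (coord k (m + 1 : ℕ) i g)
    have h2 := sum_antidiagonal_ite_snd (m + 1) v fun i ↦ φ (coord k (m + 1 : ℕ) i f)
    have hz := sum_antidiagonal_ite_ite (m + 1) m.succ_ne_zero u v
    rw [h] at h1 h2
    simp only [add_mul, mul_add, Finset.sum_add_distrib, h1, h2, hz]
    rw [Algebra.smul_def, Algebra.smul_def]
    ring

end Step

/-! ### Polynomial retracts and extension of primes -/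

section Retract

variable (k R : Type*) [CommRing k] [CommRing R] [Algebra k R] (m : ℕ)

/-- The homomorphism of coordinate rings given by the truncation of `(m + 1)`-jets to `m`-jets. -/
abbrev step : JetAlgebra k R m →ₐ[k] JetAlgebra k R (m + 1 : ℕ) :=
  transit k R (by exact_mod_cast m.le_succ)

variable {k R m}

theorem step_coord {i : ℕ} (hi : i ≤ m) (f : R) :
    step k R m (coord k m i f) = coord k (m + 1 : ℕ) i f :=
  transit_coord _ (by exact_mod_cast hi) f

theorem apply_step_eq {A : Type*} [CommRing A] [Algebra k A]
    {φ ψ : JetAlgebra k R (m + 1 : ℕ) →ₐ[k] A}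
    (h : ∀ i ≤ m, ∀ f, ψ (coord k _ i f) = φ (coord k _ i f)) (y : JetAlgebra k R m) :
    ψ (step k R m y) = φ (step k R m y) := by
  suffices h : ψ.comp (step k R m) = φ.comp (step k R m) from DFunLike.congr_fun h y
  refine hom_ext_of_le fun i hi f ↦ ?_
  have hi' : i ≤ m := by exact_mod_cast hi
  rw [AlgHom.comp_apply, AlgHom.comp_apply, step_coord hi', h i hi']

variable (k R m) in
theorem exists_step_retraction [Algebra.FormallySmooth k R] :
    ∃ r : JetAlgebra k R (m + 1 : ℕ) →ₐ[k] JetAlgebra k R m, ∀ z, r (step k R m z) = z := by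
  obtain ⟨r, hr⟩ := exists_trunc_retraction k R m
  refine ⟨r.comp (trunc k R (m + 1)), fun z ↦ ?_⟩
  rw [AlgHom.comp_apply, trunc_eq_transit, transit_transit, ← trunc_eq_transit, hr]

open KaehlerDifferential in
/-- The differentials of a formally smooth algebra have a dual basis: every derivation `d`
satisfies `d f = ∑ a, c f a • d a` for suitable coefficients `c f a`, which are derivations
in `f`. -/
theorem exists_kaehler_dual_basis [Algebra.FormallySmooth k R] :
    ∃ c : R → R →₀ R, ∀ (A : Type*) [CommRing A] [Algebra k A] [Algebra R A] [IsScalarTower k R A],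
      (∀ v : R → A, ∃ d : Derivation k R A, ∀ f, d f = (c f).sum fun a b ↦ algebraMap R A b * v a) ∧
      ∀ (d : Derivation k R A) (f : R), ((c f).sum fun a b ↦ algebraMap R A b * d a) = d f := by
  -- The differentials are projective, so the surjection from the free module on the symbols `D a`
  -- splits; `c` records the coordinates of the splitting.
  obtain ⟨s, hs⟩ := Module.projective_lifting_property
    (Finsupp.linearCombination R (D k R)) LinearMap.id (by
      rw [← LinearMap.range_eq_top, Finsupp.range_linearCombination, span_range_derivation])
  refine ⟨fun f ↦ s (D k R f), fun A _ _ _ _ ↦ ⟨fun v ↦ ?_, fun d f ↦ ?_⟩⟩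
  · refine ⟨((Finsupp.linearCombination R v).comp s).compDer (D k R), fun f ↦ ?_⟩
    simp only [← Algebra.smul_def]
    rfl
  · have h : Finsupp.linearCombination R (D k R) (s (D k R f)) = D k R f :=
      DFunLike.congr_fun hs (D k R f)
    have h' := congrArg d.liftKaehlerDifferential h
    rw [Derivation.liftKaehlerDifferential_comp_D, Finsupp.linearCombination_apply,
      map_finsuppSum] at h'
    rw [← h']
    simp only [map_smul, Derivation.liftKaehlerDifferential_comp_D, Algebra.smul_def]

variable (k R m) in
/-- For a formally smooth algebra, the algebra of `(m + 1)`-jets is a retract of a polynomial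
algebra over the algebra of `m`-jets. -/
theorem exists_mvPolynomial_retract [Algebra.FormallySmooth k R] :
    ∃ (ι : JetAlgebra k R (m + 1 : ℕ) →+* MvPolynomial R (JetAlgebra k R m))
      (ρ : MvPolynomial R (JetAlgebra k R m) →+* JetAlgebra k R (m + 1 : ℕ)),
      (∀ z, ρ (ι z) = z) ∧ (∀ y, ι (step k R m y) = MvPolynomial.C y) ∧
        ∀ y, ρ (MvPolynomial.C y) = step k R m y := by
  obtain ⟨r, hr⟩ := exists_step_retraction k R m
  let _ : Algebra R (JetAlgebra k R m) := (base k R m).toRingHom.toAlgebra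
  have : IsScalarTower k R (JetAlgebra k R m) :=
    .of_algebraMap_eq fun c ↦ ((base k R m).commutes c).symm
  let _ : Algebra R (JetAlgebra k R (m + 1 : ℕ)) := (base k R _).toRingHom.toAlgebra
  have : IsScalarTower k R (JetAlgebra k R (m + 1 : ℕ)) :=
    .of_algebraMap_eq fun c ↦ ((base k R _).commutes c).symm
  obtain ⟨c, hc⟩ := exists_kaehler_dual_basis (k := k) (R := R)
  let Cr : JetAlgebra k R (m + 1 : ℕ) →ₐ[k] MvPolynomial R (JetAlgebra k R m) :=
    (IsScalarTower.toAlgHom k (JetAlgebra k R m) _).comp r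
  have hrcoord (i : ℕ) (hi : i ≤ m) (f : R) : r (coord k _ i f) = coord k _ i f := by
    rw [← step_coord hi, hr]
  -- The variable `X a` stands for the value of a derivation at `a`; adding `d` to the top
  -- coefficient of the jet `Cr` defines `ι`.
  obtain ⟨d, hd⟩ := (hc (MvPolynomial R (JetAlgebra k R m))).1 MvPolynomial.X
  have h0 (f : R) : Cr (coord k _ 0 f) = algebraMap R (MvPolynomial R (JetAlgebra k R m)) f := by
    change MvPolynomial.C (r (coord k _ 0 f)) = _
    rw [hrcoord 0 m.zero_le]
    rfl
  obtain ⟨ι, hι, hι'⟩ := exists_add_derivation Cr h0 d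
  have h1 (f : R) : ((step k R m).comp r) (coord k _ 0 f) =
      algebraMap R (JetAlgebra k R (m + 1 : ℕ)) f := by
    rw [AlgHom.comp_apply, hrcoord 0 m.zero_le, step_coord m.zero_le]
    rfl
  have h2 (i : ℕ) (hi : i ≤ m) (f : R) : AlgHom.id k _ (coord k (m + 1 : ℕ) i f) =
      ((step k R m).comp r) (coord k _ i f) := by
    rw [AlgHom.comp_apply, hrcoord i hi, step_coord hi, AlgHom.id_apply]
  -- The universal `(m + 1)`-jet differs from the chosen lift of its truncation by the derivation
  -- `δ`, whose values are substituted for the variables in `ρ`.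
  obtain ⟨δ, hδ⟩ := exists_sub_derivation ((step k R m).comp r) (AlgHom.id k _) h1 h2
  let ρ : MvPolynomial R (JetAlgebra k R m) →+* JetAlgebra k R (m + 1 : ℕ) :=
    MvPolynomial.eval₂Hom (step k R m).toRingHom δ
  have hρC (y) : ρ (MvPolynomial.C y) = step k R m y := MvPolynomial.eval₂Hom_C _ _ _
  have hρX (f) : ρ (MvPolynomial.X f) = δ f := MvPolynomial.eval₂Hom_X' _ _ _
  have hcoord (i : ℕ) (hi : i ≤ m) (f : R) : ρ (ι (coord k _ i f)) = coord k _ i f := by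
    rw [hι i hi]
    change ρ (MvPolynomial.C (r (coord k _ i f))) = _
    rw [hrcoord i hi, hρC, step_coord hi]
  have hcoord' (f : R) : ρ (ι (coord k _ (m + 1) f)) = coord k _ (m + 1) f := by
    -- The dual basis identity for `δ` is what makes `ρ` a left inverse of `ι`.
    have h3 : ρ (d f) = δ f := by
      rw [hd, map_finsuppSum, ← (hc _).2 δ f]
      refine Finsupp.sum_congr fun a _ ↦ ?_
      rw [map_mul, hρX]
      congr 1
      exact (hρC _).trans (step_coord m.zero_le _)
    rw [hι', map_add, h3, hδ]
    change ρ (MvPolynomial.C (r (coord k _ (m + 1) f))) + _ = _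
    rw [hρC, AlgHom.comp_apply, AlgHom.id_apply]
    ring
  refine ⟨ι, ρ, fun z ↦ ?_, fun y ↦ ?_, hρC⟩
  · let ρ' : MvPolynomial R (JetAlgebra k R m) →ₐ[k] JetAlgebra k R (m + 1 : ℕ) :=
      { ρ with commutes' := fun c ↦ (hρC _).trans ((step k R m).commutes c) }
    refine DFunLike.congr_fun (hom_ext_of_le fun i hi f ↦ ?_ : ρ'.comp ι = AlgHom.id k _) z
    have hi' : i ≤ m + 1 := by exact_mod_cast hi
    rcases hi'.lt_or_eq with h | rfl
    · exact hcoord i (by omega) f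
    · exact hcoord' f
  · refine (apply_step_eq (k := k) (R := R) (m := m) (A := MvPolynomial R (JetAlgebra k R m)) (φ := Cr) (ψ := ι) hι y).trans ?_
    change MvPolynomial.C (r (step k R m y)) = _
    rw [hr]

/-- Extension of primes along a ring homomorphism with target a retract of a polynomial ring. -/
theorem _root_.Ideal.isPrime_map_of_mvPolynomial_retract {A B σ : Type*} [CommRing A] [CommRing B]
    (τ : A →+* B) (ι : B →+* MvPolynomial σ A) (ρ : MvPolynomial σ A →+* B)
    (h : ∀ z, ρ (ι z) = z) (hι : ∀ y, ι (τ y) = MvPolynomial.C y)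
    (hρ : ∀ y, ρ (MvPolynomial.C y) = τ y) (q : Ideal A) [hq : q.IsPrime] :
    (q.map τ).IsPrime ∧ (q.map τ).comap τ = q := by
  -- The extension of `q` to the polynomial ring is visibly prime; `ρ` shows that its contraction is
  -- no larger than the extension along `τ`.
  have h1 : q.map τ = (q.map MvPolynomial.C).comap ι := by
    apply le_antisymm
    · rw [Ideal.map_le_iff_le_comap]
      intro y hy
      rw [Ideal.mem_comap, Ideal.mem_comap, hι]
      exact Ideal.mem_map_of_mem _ hy
    · intro z hz
      have h2 := Ideal.mem_map_of_mem ρ (Ideal.mem_comap.1 hz)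
      rwa [h, Ideal.map_map, show ρ.comp MvPolynomial.C = τ from RingHom.ext hρ] at h2
  have h2 : (q.map (MvPolynomial.C (σ := σ))).IsPrime := by
    have h3 : q.map (MvPolynomial.C (σ := σ)) =
        RingHom.ker (MvPolynomial.map (σ := σ) (Ideal.Quotient.mk q)) := by
      rw [MvPolynomial.ker_map, Ideal.mk_ker]
    rw [h3]
    exact RingHom.ker_isPrime _
  refine ⟨h1 ▸ inferInstance, ?_⟩
  rw [h1, Ideal.comap_comap, show ι.comp τ = MvPolynomial.C from RingHom.ext hι]
  refine le_antisymm (fun y hy ↦ ?_) Ideal.le_comap_map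
  simpa using MvPolynomial.mem_map_C_iff.1 (Ideal.mem_comap.1 hy) 0

theorem map_transit_self {a : ℕ∞} (h : a ≤ a) (q : Ideal (JetAlgebra k R a)) :
    q.map (transit k R h) = q := by
  rw [show transit k R h = AlgHom.id k _ from AlgHom.ext transit_self]
  exact Ideal.map_id q

section

variable [Algebra.FormallySmooth k R]

theorem isPrime_map_step (q : Ideal (JetAlgebra k R m)) [q.IsPrime] :
    (q.map (step k R m)).IsPrime ∧ (q.map (step k R m)).comap (step k R m) = q := by
  obtain ⟨ι, ρ, h, hι, hρ⟩ := exists_mvPolynomial_retract k R m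
  exact Ideal.isPrime_map_of_mvPolynomial_retract (step k R m).toRingHom ι ρ h hι hρ q

-- The `0`-jets give `R` itself, and each further algebra embeds in a polynomial ring over the
-- previous one.
variable (k R) in
instance isDomain [IsDomain R] (m : ℕ) : IsDomain (JetAlgebra k R m) := by
  induction m with
  | zero => exact (baseEquiv k R).symm.injective.isDomain (baseEquiv k R).symm.toRingHom
  | succ m ih =>
    obtain ⟨ι, ρ, h, -⟩ := exists_mvPolynomial_retract k R m
    exact (Function.LeftInverse.injective h).isDomain ι

theorem isPrime_map_transit {a b : ℕ} (hab : a ≤ b) (hab' : (a : ℕ∞) ≤ b)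
    (q : Ideal (JetAlgebra k R a)) [q.IsPrime] :
    (q.map (transit k R hab')).IsPrime ∧
      (q.map (transit k R hab')).comap (transit k R hab') = q := by
  induction b, hab using Nat.le_induction with
  | base =>
    rw [map_transit_self]
    exact ⟨inferInstance, Ideal.ext fun z ↦ by rw [Ideal.mem_comap, transit_self]⟩
  | succ b hab ih =>
    have hab'' : (a : ℕ∞) ≤ b := by exact_mod_cast hab
    obtain ⟨h1, h2⟩ := ih hab''
    obtain ⟨h3, h4⟩ := isPrime_map_step (q.map (transit k R hab''))
    have h : transit k R hab' = (step k R b).comp (transit k R hab'') := (transit_comp _ _).symm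
    rw [h, ← Ideal.map_mapₐ, ← Ideal.comap_comapₐ, h4]
    exact ⟨h3, h2⟩

theorem trunc_injective : Function.Injective (trunc k R m) := by
  obtain ⟨r, hr⟩ := exists_trunc_retraction k R m
  exact Function.LeftInverse.injective hr

/-- The arc algebra is the union of its finite levels, and a retraction onto level `a` shows that
the extension of `q` meets that level in the extension of `q` to it. Primality is thus checked at
finite levels. -/
theorem isPrime_map_trunc (q : Ideal (JetAlgebra k R m)) [q.IsPrime] :
    (q.map (trunc k R m)).IsPrime ∧ (q.map (trunc k R m)).comap (trunc k R m) = q := by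
  have key (a : ℕ) (ha : (m : ℕ∞) ≤ a) (z : JetAlgebra k R a)
      (hz : trunc k R a z ∈ q.map (trunc k R m)) : z ∈ q.map (transit k R ha) := by
    obtain ⟨r, hr⟩ := exists_trunc_retraction k R a
    have h1 := Ideal.mem_map_of_mem r hz
    have h2 : r.comp (trunc k R m) = transit k R ha := by
      ext y
      rw [AlgHom.comp_apply, ← hr (transit k R ha y), trunc_eq_transit, trunc_eq_transit,
        transit_transit]
    rwa [Ideal.map_mapₐ, h2, hr] at h1
  have key' (a : ℕ) (ha : (m : ℕ∞) ≤ a) (z : JetAlgebra k R a)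
      (hz : z ∈ q.map (transit k R ha)) : trunc k R a z ∈ q.map (trunc k R m) := by
    have h1 := Ideal.mem_map_of_mem (trunc k R a) hz
    rwa [Ideal.map_mapₐ, trunc_eq_transit, transit_comp, ← trunc_eq_transit,
      ← trunc_eq_transit] at h1
  have hself (z : JetAlgebra k R m) (hz : trunc k R m z ∈ q.map (trunc k R m)) : z ∈ q := by
    have h1 := key m le_rfl z hz
    rwa [map_transit_self] at h1
  refine ⟨⟨fun h ↦ ?_, fun {x y} hxy ↦ ?_⟩, le_antisymm (fun z hz ↦ hself z hz) Ideal.le_comap_map⟩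
  · refine ‹q.IsPrime›.ne_top ((Ideal.eq_top_iff_one q).2 (hself 1 ?_))
    rw [h]
    trivial
  · obtain ⟨a, ha, x, rfl⟩ := exists_trunc_eq x m
    obtain ⟨b, hb, y, rfl⟩ := exists_trunc_eq y a
    have hab : (a : ℕ∞) ≤ b := by exact_mod_cast hb
    have hmb : (m : ℕ∞) ≤ b := by exact_mod_cast ha.le.trans hb
    have hx : trunc k R a x = trunc k R b (transit k R hab x) := by
      rw [trunc_eq_transit, trunc_eq_transit, transit_transit]
    rw [hx] at hxy ⊢
    rw [← map_mul] at hxy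
    have := (isPrime_map_transit (ha.le.trans hb) hmb q).1
    rcases this.mem_or_mem (key b hmb _ hxy) with h | h
    · exact Or.inl (key' b hmb _ h)
    · exact Or.inr (key' b hmb _ h)

end

end Retract

end JetAlgebra

/-! ## Derivations and transcendence bases in characteristic zero -/

section Derivation

open TensorProduct in
/-- Derivations extend uniquely along formally étale extensions. -/
theorem Derivation.exists_extension_of_formallyEtale {k P K M : Type*} [CommRing k] [CommRing P]
    [CommRing K] [Algebra k P] [Algebra P K] [Algebra k K] [IsScalarTower k P K]
    [Algebra.FormallyEtale P K] [AddCommGroup M] [Module k M] [Module P M] [Module K M]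
    [IsScalarTower P K M] [IsScalarTower k K M] [IsScalarTower k P M] (d₀ : Derivation k P M) :
    ∃ d : Derivation k K M, ∀ p, d (algebraMap P K p) = d₀ p := by
  let e := KaehlerDifferential.tensorKaehlerEquivOfFormallyEtale k P K
  let l : KaehlerDifferential k K →ₗ[K] M :=
    (LinearMap.liftBaseChange K d₀.liftKaehlerDifferential).comp e.symm.toLinearMap
  refine ⟨l.compDer (KaehlerDifferential.D k K), fun p ↦ ?_⟩
  change (LinearMap.liftBaseChange K d₀.liftKaehlerDifferential)
    (e.symm (KaehlerDifferential.D k K (algebraMap P K p))) = _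
  rw [KaehlerDifferential.tensorKaehlerEquivOfFormallyEtale_symm_D_algebraMap]
  simp

variable {k R ι : Type*} [Field k] [CharZero k] [CommRing R] [IsDomain R] [Algebra k R]
  {x : ι → R}

/-- A derivation with values in a torsion-free module is determined by its values on a
transcendence basis. -/
theorem Derivation.eq_zero_of_isTranscendenceBasis (hx : IsTranscendenceBasis k x) {M : Type*}
    [AddCommGroup M] [Module k M] [Module R M] [IsScalarTower k R M]
    (htf : ∀ (a : R) (z : M), a ≠ 0 → a • z = 0 → z = 0) (d : Derivation k R M)
    (hd : ∀ i, d (x i) = 0) (f : R) : d f = 0 := by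
  let S := Algebra.adjoin k (Set.range x)
  have hS (s : S) : d s = 0 := by
    have h : Set.EqOn d (0 : Derivation k R M) (Set.range x) := by
      rintro _ ⟨i, rfl⟩
      exact hd i
    exact Derivation.eqOn_adjoin h s.2
  have hp (p : Polynomial S) :
      d (Polynomial.aeval f p) = Polynomial.aeval f p.derivative • d f := by
    let d' : Derivation S R M := Derivation.mk'
      { toFun := d
        map_add' := d.map_add
        map_smul' := fun s g ↦ by
          rw [Algebra.smul_def, Derivation.leibniz, show d (algebraMap S R s) = 0 from hS s,
            smul_zero, add_zero]
          rfl } (fun a b ↦ d.leibniz a b)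
    exact d'.map_aeval p f
  -- An annihilating polynomial is differentiated until its derivative no longer vanishes at `f`;
  -- characteristic zero ensures that only constants have zero derivative.
  have key (n : ℕ) (p : Polynomial S) (hn : p.natDegree ≤ n) (h0 : p ≠ 0)
      (hf : Polynomial.aeval f p = 0) : d f = 0 := by
    induction n generalizing p with
    | zero =>
      exfalso
      rw [Polynomial.eq_C_of_natDegree_le_zero hn, Polynomial.aeval_C] at hf
      apply h0
      rw [Polynomial.eq_C_of_natDegree_le_zero hn,
        (FaithfulSMul.algebraMap_eq_zero_iff S R).1 hf, map_zero]
    | succ n ih =>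
      by_cases hd' : Polynomial.aeval f p.derivative = 0
      · by_cases hdz : p.derivative = 0
        · have : CharZero S := charZero_of_injective_algebraMap (algebraMap k S).injective
          exact ih p (by rw [Polynomial.derivative_eq_zero.1 hdz]; omega) h0 hf
        · refine ih _ ?_ hdz hd'
          have := Polynomial.natDegree_derivative_le p
          omega
      · refine htf _ _ hd' ?_
        rw [← hp, hf, map_zero]
  obtain ⟨p, hp0, hpf⟩ := hx.isAlgebraic.isAlgebraic f
  exact key _ p le_rfl hp0 hpf

/-- A derivation with values in a vector space over a field containing `R` can take arbitrary values
on a transcendence basis. -/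
theorem exists_derivation_of_isTranscendenceBasis (hx : IsTranscendenceBasis k x)
    (F A : Type*) [Field F] [CommRing A] [Algebra k F] [Algebra R F] [FaithfulSMul R F]
    [IsScalarTower k R F] [Algebra F A] [Algebra R A] [Algebra k A] [IsScalarTower R F A]
    [IsScalarTower k R A] (v : ι → A) : ∃ d : Derivation k R A, ∀ i, d (x i) = v i := by
  let P := MvPolynomial ι k
  let _ : Algebra P R := (MvPolynomial.aeval x).toRingHom.toAlgebra
  have hPR : Function.Injective (algebraMap P R) := hx.1
  have : IsScalarTower k P R := .of_algebraMap_eq fun c ↦ ((MvPolynomial.aeval x).commutes c).symm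
  have : FaithfulSMul P R := (faithfulSMul_iff_algebraMap_injective _ _).2 hPR
  have : Algebra.IsAlgebraic P R := by
    have := hx.isAlgebraic
    exact Algebra.IsAlgebraic.of_ringHom_of_comp_eq hx.1.aevalEquiv.toRingHom (RingHom.id R)
      hx.1.aevalEquiv.surjective Function.injective_id (RingHom.ext fun p ↦ by
        exact hx.1.algebraMap_aevalEquiv p)
  let K := FractionRing R
  let L := FractionRing P
  have : FaithfulSMul P K := (faithfulSMul_iff_algebraMap_injective _ _).2 (by
    rw [IsScalarTower.algebraMap_eq P R K]
    exact (IsFractionRing.injective R K).comp hPR)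
  let _ : Algebra L K := FractionRing.liftAlgebra P K
  have : Algebra.IsAlgebraic P K := (IsFractionRing.isAlgebraic_iff' P R K).1 inferInstance
  have : Algebra.IsAlgebraic L K := (IsFractionRing.comap_isAlgebraic_iff (A := P)).1 inferInstance
  have : CharZero L := charZero_of_injective_algebraMap (algebraMap k L).injective
  -- An algebraic extension in characteristic zero is separable, so `K` is formally étale over `P`,
  -- and the derivation prescribed on the variables extends uniquely.
  have : Algebra.FormallyEtale L K := Algebra.FormallyEtale.of_isSeparable L K
  have : Algebra.FormallyEtale P L := Algebra.FormallyEtale.of_isLocalization (nonZeroDivisors P)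
  have : Algebra.FormallyEtale P K := Algebra.FormallyEtale.comp P L K
  let _ : Algebra K F := FractionRing.liftAlgebra R F
  let _ : Algebra K A := ((algebraMap F A).comp (algebraMap K F)).toAlgebra
  have : IsScalarTower R K A := .of_algebraMap_eq fun a ↦ by
    change _ = algebraMap F A (algebraMap K F (algebraMap R K a))
    rw [← IsScalarTower.algebraMap_apply R K F, ← IsScalarTower.algebraMap_apply R F A]
  have : IsScalarTower k K A := .of_algebraMap_eq fun c ↦ by
    rw [IsScalarTower.algebraMap_apply k R K, ← IsScalarTower.algebraMap_apply R K A,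
      ← IsScalarTower.algebraMap_apply k R A]
  let _ : Algebra P A := ((algebraMap R A).comp (algebraMap P R)).toAlgebra
  have : IsScalarTower P K A := .of_algebraMap_eq fun p ↦ by
    rw [IsScalarTower.algebraMap_apply P R K, ← IsScalarTower.algebraMap_apply R K A]
    rfl
  have : IsScalarTower k P A := .of_algebraMap_eq fun c ↦ by
    rw [IsScalarTower.algebraMap_apply P K A, ← IsScalarTower.algebraMap_apply k P K,
      ← IsScalarTower.algebraMap_apply k K A]
  obtain ⟨d, hd⟩ := Derivation.exists_extension_of_formallyEtale (k := k) (P := P) (K := K) (M := A)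
    (MvPolynomial.mkDerivation k v)
  refine ⟨d.compAlgebraMap R, fun i ↦ ?_⟩
  have h := hd (MvPolynomial.X i)
  rw [MvPolynomial.mkDerivation_X] at h
  rw [← h]
  change d (algebraMap R K (x i)) = _
  congr 1
  rw [IsScalarTower.algebraMap_apply P R K]
  congr 1
  exact (MvPolynomial.aeval_X x i).symm

end Derivation

/-! ## The dimension of the jet schemes -/

namespace JetAlgebra

theorem base_injective {k R : Type*} [CommRing k] [CommRing R] [Algebra k R]
    [Algebra.FormallySmooth k R] (n : ℕ) : Function.Injective (base k R n) := by
  have h (c : R) : trunc k R 0 (baseEquiv k R c) = trunc k R n (base k R n c) := by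
    change trunc k R 0 (coord k _ 0 c) = trunc k R n (coord k _ 0 c)
    rw [trunc_coord, trunc_coord, if_pos le_rfl, if_pos n.zero_le]
  intro a b hab
  apply (baseEquiv k R).injective
  apply trunc_injective
  rw [h, h, hab]

section Dimension

variable {k R : Type*} [Field k] [CharZero k] [CommRing R] [IsDomain R] [Algebra k R]
  [Algebra.FormallySmooth k R]

/-- The top coefficients of a transcendence basis, up to a correction of lower order, form a
transcendence basis of the algebra of `(m + 1)`-jets over the algebra of `m`-jets. -/
theorem exists_isTranscendenceBasis_step {ι : Type*} {x : ι → R} (hx : IsTranscendenceBasis k x)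
    (m : ℕ) :
    letI := (step k R m).toRingHom.toAlgebra
    ∃ y : ι → JetAlgebra k R (m + 1 : ℕ), IsTranscendenceBasis (JetAlgebra k R m) y := by
  let B := JetAlgebra k R m
  let B' := JetAlgebra k R (m + 1 : ℕ)
  let _ : Algebra B B' := (step k R m).toRingHom.toAlgebra
  obtain ⟨r, hr⟩ := exists_step_retraction k R m
  let _ : Algebra R B := (base k R m).toRingHom.toAlgebra
  have : IsScalarTower k R B := .of_algebraMap_eq fun c ↦ ((base k R m).commutes c).symm
  let _ : Algebra R B' := (base k R _).toRingHom.toAlgebra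
  have : IsScalarTower k R B' := .of_algebraMap_eq fun c ↦ ((base k R _).commutes c).symm
  have : IsScalarTower k B B' := .of_algebraMap_eq fun c ↦ ((step k R m).commutes c).symm
  let F := FractionRing B
  let A := MvPolynomial ι F
  have : FaithfulSMul R F := (faithfulSMul_iff_algebraMap_injective _ _).2 <| by
    rw [IsScalarTower.algebraMap_eq R B F]
    exact (IsFractionRing.injective B F).comp (base_injective m)
  -- Adding this derivation to the top coefficient gives `ψ`, which sends the candidates `δ (x i)`
  -- to independent variables.
  obtain ⟨d, hd⟩ := exists_derivation_of_isTranscendenceBasis hx F A MvPolynomial.X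
  have hrcoord (i : ℕ) (hi : i ≤ m) (f : R) : r (coord k _ i f) = coord k _ i f := by
    rw [← step_coord hi, hr]
  let φ : B' →ₐ[k] A := (IsScalarTower.toAlgHom k B A).comp r
  have h0 (f : R) : φ (coord k _ 0 f) = algebraMap R A f := by
    change algebraMap B A (r (coord k _ 0 f)) = _
    rw [hrcoord 0 m.zero_le]
    rfl
  obtain ⟨ψ, hψ, hψ'⟩ := exists_add_derivation φ h0 d
  have h1 (f : R) : ((step k R m).comp r) (coord k _ 0 f) =
      algebraMap R (JetAlgebra k R (m + 1 : ℕ)) f := by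
    rw [AlgHom.comp_apply, hrcoord 0 m.zero_le, step_coord m.zero_le]
    rfl
  have h2 (i : ℕ) (hi : i ≤ m) (f : R) : AlgHom.id k _ (coord k (m + 1 : ℕ) i f) =
      ((step k R m).comp r) (coord k _ i f) := by
    rw [AlgHom.comp_apply, hrcoord i hi, step_coord hi, AlgHom.id_apply]
  obtain ⟨δ, hδ⟩ := exists_sub_derivation ((step k R m).comp r) (AlgHom.id k _) h1 h2
  have hψC (b : B) : ψ (step k R m b) = algebraMap B A b := by
    refine (apply_step_eq (k := k) (R := R) (m := m) (A := A) (φ := φ) (ψ := ψ) hψ b).trans ?_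
    change algebraMap B A (r (step k R m b)) = _
    rw [hr]
  have hψδ (i : ι) : ψ (δ (x i)) = MvPolynomial.X i := by
    rw [hδ, map_sub, AlgHom.id_apply, hψ', hd]
    refine (congrArg (_ - ·) (hψC _)).trans ?_
    exact add_sub_cancel_left _ _
  refine ⟨fun i ↦ δ (x i), (AlgebraicIndependent.isTranscendenceBasis_iff_isAlgebraic ?_).2 ?_⟩
  · have h : ψ.toRingHom.comp
        (MvPolynomial.aeval (R := B) (fun i ↦ δ (x i))).toRingHom =
        MvPolynomial.map (algebraMap B F) := by
      apply MvPolynomial.ringHom_ext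
      · intro b
        change ψ (MvPolynomial.aeval _ (MvPolynomial.C b)) = _
        rw [MvPolynomial.aeval_C, MvPolynomial.map_C]
        exact hψC b
      · intro i
        change ψ (MvPolynomial.aeval _ (MvPolynomial.X i)) = _
        rw [MvPolynomial.aeval_X, MvPolynomial.map_X]
        exact hψδ i
    have hinj := MvPolynomial.map_injective (σ := ι) (algebraMap B F) (IsFractionRing.injective B F)
    rw [← h] at hinj
    exact Function.Injective.of_comp hinj
  · let S := Algebra.adjoin B (Set.range fun i ↦ δ (x i))
    have hS (b : B) : IsAlgebraic S (step k R m b) := isAlgebraic_algebraMap (algebraMap B S b)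
    have hbase (a : R) : base k R (m + 1 : ℕ) a = step k R m (base k R m a) :=
      (step_coord m.zero_le a).symm
    -- The quotient by the elements algebraic over `S` is torsion-free over `R`, and `δ` modulo `T`
    -- vanishes on the transcendence basis, hence everywhere.
    let T : Submodule R B' :=
      { carrier := {z | IsAlgebraic S z}
        add_mem' := IsAlgebraic.add
        zero_mem' := isAlgebraic_zero
        smul_mem' := fun a z hz ↦ by
          rw [Algebra.smul_def]
          exact IsAlgebraic.mul ((hbase a).symm ▸ hS _ : IsAlgebraic S (base k R _ a)) hz }
    have hδT (f : R) : IsAlgebraic S (δ f) := by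
      have h3 := Derivation.eq_zero_of_isTranscendenceBasis hx
        (M := B' ⧸ T) ?_ (T.mkQ.compDer δ) ?_ f
      · exact (Submodule.Quotient.mk_eq_zero T).1 h3
      · intro a z ha hz
        obtain ⟨z, rfl⟩ := Submodule.Quotient.mk_surjective T z
        rw [← Submodule.Quotient.mk_smul, Submodule.Quotient.mk_eq_zero] at hz
        rw [Submodule.Quotient.mk_eq_zero]
        have h4 : base k R (m + 1 : ℕ) a ≠ 0 := by
          rwa [Ne, map_eq_zero_iff _ (base_injective _)]
        refine IsAlgebraic.of_mul (y := base k R (m + 1 : ℕ) a) (mem_nonZeroDivisors_of_ne_zero h4)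
          ((hbase a).symm ▸ hS _) ?_
        rw [Algebra.smul_def] at hz
        exact hz
      · intro i
        exact (Submodule.Quotient.mk_eq_zero T).2
          (isAlgebraic_algebraMap (⟨_, Algebra.subset_adjoin ⟨i, rfl⟩⟩ : S))
    let U : Subalgebra k B' :=
      { carrier := {z | IsAlgebraic S z}
        add_mem' := IsAlgebraic.add
        mul_mem' := IsAlgebraic.mul
        algebraMap_mem' := fun c ↦ by
          have := hS (algebraMap k B c)
          rwa [AlgHom.commutes] at this }
    have hU : U = ⊤ := eq_top_of_coord_mem U fun i hi f ↦ by
      have hi' : i ≤ m + 1 := by exact_mod_cast hi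
      rcases hi'.lt_or_eq with h | rfl
      · have := hS (coord k m i f)
        rwa [step_coord (by omega)] at this
      -- A top coefficient is a value of `δ` plus a function of order `m`.
      · have h3 : coord k (m + 1 : ℕ) (m + 1) f =
            δ f + step k R m (r (coord k (m + 1 : ℕ) (m + 1) f)) := by
          rw [hδ, AlgHom.id_apply, AlgHom.comp_apply]
          ring
        rw [h3]
        exact IsAlgebraic.add (hδT f) (hS _)
    exact ⟨fun z ↦ (hU ▸ Algebra.mem_top : z ∈ U)⟩

/-- Each of the levels `0, …, m` contributes `n` elements to a transcendence basis. -/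
theorem ringKrullDim_eq [Algebra.FiniteType k R] {n : ℕ} (hn : ringKrullDim R = n) (m : ℕ) :
    ringKrullDim (JetAlgebra k R m) = ((m + 1) * n : ℕ) := by
  obtain ⟨s, x, hx, hs⟩ := exists_isTranscendenceBasis_fin k R
  obtain rfl : s = n := by rw [hn] at hs; exact_mod_cast hs.symm
  obtain ⟨κ, _, y, hy, hcard⟩ : ∃ (κ : Type) (_ : Finite κ) (y : κ → JetAlgebra k R m),
      IsTranscendenceBasis k y ∧ Nat.card κ = (m + 1) * s := by
    induction m with
    | zero => exact ⟨Fin s, inferInstance, _, (baseEquiv k R).isTranscendenceBasis hx, by simp⟩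
    | succ m ih =>
      obtain ⟨κ, _, y, hy, hcard⟩ := ih
      let _ : Algebra (JetAlgebra k R m) (JetAlgebra k R (m + 1 : ℕ)) :=
        (step k R m).toRingHom.toAlgebra
      have : IsScalarTower k (JetAlgebra k R m) (JetAlgebra k R (m + 1 : ℕ)) :=
        .of_algebraMap_eq fun c ↦ ((step k R m).commutes c).symm
      obtain ⟨z, hz⟩ := exists_isTranscendenceBasis_step hx m
      refine ⟨Fin s ⊕ κ, inferInstance, _, hy.sumElim_comp hz, ?_⟩
      rw [Nat.card_sum, hcard, Nat.card_fin]
      ring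
  rw [ringKrullDim_eq_card_of_isTranscendenceBasis hy, hcard]

end Dimension

end JetAlgebra

/-! ## Heights of primes of the arc algebra -/

/-- If the primes of `A` extend to primes of `B` lying over them, then contraction does not increase
heights. -/
theorem Ideal.height_comap_le_of_isPrime_map {A B : Type*} [CommRing A] [CommRing B] (τ : A →+* B)
    (h : ∀ q : Ideal A, q.IsPrime → (q.map τ).IsPrime ∧ (q.map τ).comap τ = q)
    (P : Ideal B) [P.IsPrime] : (P.comap τ).height ≤ P.height := by
  -- Extension of primes is strictly increasing because contraction undoes it, and the extended
  -- contraction of `P` lies in `P`.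
  let g : PrimeSpectrum A → PrimeSpectrum B := fun q ↦ ⟨q.asIdeal.map τ, (h _ q.2).1⟩
  have hg : StrictMono g := fun q q' hq ↦ by
    refine lt_of_le_not_ge (Ideal.map_mono hq.le) fun hle ↦ hq.not_ge ?_
    have := Ideal.comap_mono (f := τ) hle
    rwa [(h _ q.2).2, (h _ q'.2).2] at this
  have h1 := Order.height_le_height_apply_of_strictMono g hg ⟨P.comap τ, inferInstance⟩
  rw [← PrimeSpectrum.height_eq_orderHeight, ← PrimeSpectrum.height_eq_orderHeight] at h1
  exact h1.trans (Ideal.height_mono Ideal.map_comap_le)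

namespace JetAlgebra

section Height

variable {k R : Type*} [Field k] [CommRing R] [Algebra k R]

theorem comap_transit_comap_trunc {a b : ℕ} (hab : (a : ℕ∞) ≤ b) (p : Ideal (JetAlgebra k R ⊤)) :
    (p.comap (trunc k R b)).comap (transit k R hab) = p.comap (trunc k R a) := by
  rw [Ideal.comap_comapₐ, trunc_eq_transit, transit_comp, ← trunc_eq_transit]

variable [Algebra.FormallySmooth k R]

theorem height_comap_trunc_mono (p : Ideal (JetAlgebra k R ⊤)) [p.IsPrime] :
    Monotone fun m : ℕ ↦ (p.comap (trunc k R m)).height := by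
  intro a b hab
  have hab' : (a : ℕ∞) ≤ b := by exact_mod_cast hab
  dsimp only
  rw [← comap_transit_comap_trunc hab' p]
  exact Ideal.height_comap_le_of_isPrime_map (transit k R hab').toRingHom
    (fun q _ ↦ isPrime_map_transit hab hab' q) _

theorem height_comap_trunc_le (p : Ideal (JetAlgebra k R ⊤)) [p.IsPrime] (m : ℕ) :
    (p.comap (trunc k R m)).height ≤ p.height :=
  Ideal.height_comap_le_of_isPrime_map (trunc k R m).toRingHom (fun q _ ↦ isPrime_map_trunc q) p

/-- A function witnessing `q < p` lives at a finite level, so from there on the heights of the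
contractions differ by at least one. Monotonicity spreads the bound `d - 1` for `q` to all levels,
and induction applies. -/
theorem height_le_of_comap_trunc_le (d : ℕ) (p : Ideal (JetAlgebra k R ⊤)) [p.IsPrime]
    (h : ∀ m : ℕ, (p.comap (trunc k R m)).height ≤ d) : p.height ≤ d := by
  have key (q p : Ideal (JetAlgebra k R ⊤)) (hq : q.IsPrime) (hp : p.IsPrime) (hqp : q < p) :
      ∃ m, ∀ a ≥ m, (q.comap (trunc k R a)).height + 1 ≤ (p.comap (trunc k R a)).height := by
    obtain ⟨hle, z, hzp, hzq⟩ := SetLike.lt_iff_le_and_exists.1 hqp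
    obtain ⟨m, -, y, rfl⟩ := exists_trunc_eq z 0
    refine ⟨m, fun a ha ↦ Ideal.height_add_one_le_of_lt_of_isPrime ?_⟩
    refine lt_of_le_not_ge (Ideal.comap_mono hle) fun hge ↦ hzq ?_
    have ha' : (m : ℕ∞) ≤ a := by exact_mod_cast ha
    have h1 := Ideal.comap_mono (f := transit k R ha') hge
    rw [comap_transit_comap_trunc, comap_transit_comap_trunc] at h1
    exact h1 hzp
  rw [Ideal.height_le_iff]
  induction d generalizing p with
  | zero =>
    intro q _ hqp
    obtain ⟨m, hm⟩ := key q p inferInstance inferInstance hqp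
    have h1 := hm m le_rfl
    have h2 := (h m).trans' h1
    simp at h2
  | succ d ih =>
    intro q _ hqp
    obtain ⟨m, hm⟩ := key q p inferInstance inferInstance hqp
    have h1 (a : ℕ) : (q.comap (trunc k R a)).height ≤ d := by
      refine (height_comap_trunc_mono q (le_max_left a m)).trans ?_
      have h2 := (hm _ (le_max_right a m)).trans (h _)
      rw [Nat.cast_succ] at h2
      exact (ENat.add_le_add_iff_right ENat.one_ne_top).1 h2
    have h3 : q.height ≤ d := Ideal.height_le_iff.2 (ih q h1)
    exact h3.trans_lt (by exact_mod_cast d.lt_succ_self)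

theorem height_eq_iSup (p : Ideal (JetAlgebra k R ⊤)) [p.IsPrime] :
    p.height = ⨆ m : ℕ, (p.comap (trunc k R m)).height := by
  apply le_antisymm _ (iSup_le (height_comap_trunc_le p))
  generalize hs : (⨆ m : ℕ, (p.comap (trunc k R m)).height) = s
  cases s with
  | top => exact le_top
  | coe d => exact height_le_of_comap_trunc_le d p fun m ↦
      hs ▸ le_iSup (fun m : ℕ ↦ (p.comap (trunc k R m)).height) m

variable [Algebra.FiniteType k R]

instance isNoetherianRing (m : ℕ) : IsNoetherianRing (JetAlgebra k R m) :=
  Algebra.FiniteType.isNoetherianRing k _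

/-- A finite height is attained at some level `m`. At each higher level the extension of the
contraction to level `m` is a prime inside the contraction of `p` with at least the same height, so
they agree. -/
theorem exists_map_comap_trunc_eq (p : Ideal (JetAlgebra k R ⊤)) [p.IsPrime] (hp : p.height ≠ ⊤) :
    ∃ m, (p.comap (trunc k R m)).map (trunc k R m) = p := by
  obtain ⟨m, hm⟩ : ∃ m : ℕ, p.height ≤ (p.comap (trunc k R m)).height := by
    by_contra! h
    obtain ⟨d, hd⟩ := ENat.ne_top_iff_exists.1 hp
    cases d with
    | zero =>
      have := h 0
      rw [← hd] at this
      simp at this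
    | succ d =>
      have h1 : p.height ≤ d := height_le_of_comap_trunc_le d p fun m ↦ by
        have := h m
        rw [← hd, Nat.cast_succ] at this
        exact Order.le_of_lt_add_one this
      rw [← hd] at h1
      norm_cast at h1
      omega
  refine ⟨m, le_antisymm Ideal.map_comap_le fun z hz ↦ ?_⟩
  obtain ⟨a, ha, y, rfl⟩ := exists_trunc_eq z m
  have ha' : (m : ℕ∞) ≤ a := by exact_mod_cast ha
  obtain ⟨h1, h2⟩ := isPrime_map_transit ha ha' (p.comap (trunc k R m))
  have h3 : (p.comap (trunc k R m)).map (transit k R ha') ≤ p.comap (trunc k R a) := by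
    rw [Ideal.map_le_iff_le_comap, comap_transit_comap_trunc]
  have h4 : (p.comap (trunc k R a)).height ≤
      ((p.comap (trunc k R m)).map (transit k R ha')).height := by
    refine (height_comap_trunc_le p a).trans (hm.trans ?_)
    have := Ideal.height_comap_le_of_isPrime_map (transit k R ha').toRingHom
      (fun q _ ↦ isPrime_map_transit ha ha' q) ((p.comap (trunc k R m)).map (transit k R ha'))
    exact (congrArg Ideal.height h2).ge.trans this
  have : Ideal.IsPrime ((p.comap (trunc k R m)).map (transit k R ha')) := h1
  have : Ideal.IsPrime (p.comap (trunc k R a)) := inferInstance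
  have h5 : (p.comap (trunc k R m)).map (transit k R ha') = p.comap (trunc k R a) :=
    Ideal.eq_of_le_of_height_le _ h3 h4
  have h6 : y ∈ (p.comap (trunc k R m)).map (transit k R ha') := h5 ▸ hz
  have h7 := Ideal.mem_map_of_mem (trunc k R a) h6
  rwa [Ideal.map_mapₐ, trunc_eq_transit, transit_comp, ← trunc_eq_transit,
      ← trunc_eq_transit] at h7

/-- The same finite set of generators works at all higher levels, so Krull's height theorem gives a
bound independent of the level. -/
theorem height_map_trunc_ne_top {m : ℕ} (q : Ideal (JetAlgebra k R m)) [q.IsPrime] :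
    (q.map (trunc k R m)).height ≠ ⊤ := by
  have := (isPrime_map_trunc q).1
  obtain ⟨s, hs⟩ := (isNoetherianRing_iff_ideal_fg _).1 (isNoetherianRing (k := k) (R := R) m) q
  have h : ∀ a : ℕ, ((q.map (trunc k R m)).comap (trunc k R a)).height ≤ s.card := by
    intro a
    refine (height_comap_trunc_mono (q.map (trunc k R m)) (le_max_left a m)).trans ?_
    have hb : (m : ℕ∞) ≤ (max a m : ℕ) := by exact_mod_cast le_max_right a m
    have h1 := (isPrime_map_transit (le_max_right a m) hb q).1
    have h2 : (q.map (trunc k R m)).comap (trunc k R (max a m)) = q.map (transit k R hb) := by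
      rw [← (isPrime_map_trunc (q.map (transit k R hb))).2, Ideal.map_mapₐ,
        trunc_eq_transit (max a m), transit_comp, ← trunc_eq_transit, ← trunc_eq_transit]
    dsimp only
    rw [h2]
    refine (Ideal.height_le_spanFinrank _ h1.ne_top).trans ?_
    rw [← hs, Ideal.map_span]
    refine (Submodule.spanFinrank_span_le_encard _).trans ?_
    exact (Set.encard_image_le _ _).trans (Set.encard_coe_eq_coe_finsetCard s).le
  exact ne_top_of_le_ne_top (ENat.natCast_ne_top _) (height_le_of_comap_trunc_le _ _ h)

end Height

end JetAlgebra

/-! ## Codimensions of closed irreducible subsets -/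

open Filter PrimeSpectrum

theorem PrimeSpectrum.topologicalKrullDim_zeroLocus {A : Type*} [CommRing A] (I : Ideal A) :
    topologicalKrullDim (zeroLocus (I : Set A)) = ringKrullDim (A ⧸ I) := by
  have h := isClosedEmbedding_comap_of_surjective _ (Ideal.Quotient.mk I)
    Ideal.Quotient.mk_surjective
  have hr : Set.range (comap (Ideal.Quotient.mk I)) = zeroLocus (I : Set A) := by
    rw [range_comap_of_surjective _ _ Ideal.Quotient.mk_surjective, Ideal.mk_ker]
  rw [← topologicalKrullDim_eq_ringKrullDim]
  exact (IsHomeomorph.topologicalKrullDim_eq _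
    (h.isEmbedding.toHomeomorph.trans (Homeomorph.setCongr hr)).isHomeomorph).symm

theorem krullCodimIrred_eq_height {B : Type*} [CommRing B] (Z : Set (PrimeSpectrum B))
    (hZ : IsIrreducible Z) : krullCodimIrred Z hZ = (vanishingIdeal Z).height := by
  have := isIrreducible_iff_vanishingIdeal_isPrime.1 hZ
  exact IsLocalization.AtPrime.ringKrullDim_eq_height (vanishingIdeal Z) _

theorem isClosed_of_mem_irredComponentsOf {T : Type*} [TopologicalSpace T] {F Z : Set T}
    (hF : IsClosed F) (hZ : Z ∈ irredComponentsOf F) : IsClosed Z :=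
  isClosed_of_closure_subset <|
    hZ.2 ⟨hZ.1.1.closure, closure_minimal hZ.1.2 hF⟩ subset_closure

theorem irredComponentsOf_of_isIrreducible {T : Type*} [TopologicalSpace T] {F : Set T}
    (hF : IsIrreducible F) : irredComponentsOf F = {F} := by
  ext Z
  refine ⟨fun h ↦ h.1.2.antisymm (h.2 ⟨hF, subset_rfl⟩ h.1.2), ?_⟩
  rintro rfl
  exact ⟨⟨hF, subset_rfl⟩, fun S hS _ ↦ hS.2⟩

theorem krullCodim_of_isIrreducible {B : Type*} [CommRing B] {C : Set (PrimeSpectrum B)}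
    (hC : IsClosed C) (hC' : IsIrreducible C) :
    krullCodim C = (vanishingIdeal C).height := by
  unfold krullCodim
  simp_rw [krullCodimIrred_eq_height]
  rw [hC.closure_eq, irredComponentsOf_of_isIrreducible hC']
  simp

theorem dimToEReal_coe (d : ℕ∞) : dimToEReal (d : WithBot ℕ∞) = ((d : ENNReal) : EReal) := rfl

theorem dimToEReal_natCast (d : ℕ) : dimToEReal (d : WithBot ℕ∞) = ((d : ℝ) : EReal) := by
  refine (dimToEReal_coe (d : ℕ∞)).trans ?_
  rw [ENat.toENNReal_coe]
  exact EReal.coe_nnreal_eq_coe_real (d : NNReal)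

theorem dimToEReal_top : dimToEReal ⊤ = ⊤ := by
  refine (dimToEReal_coe ⊤).trans ?_
  simp

theorem dimToEReal_mono : Monotone dimToEReal := by
  intro a b hab
  induction a with
  | bot => exact bot_le
  | coe a =>
    induction b with
    | bot => exact absurd hab (by simp)
    | coe b =>
      rw [dimToEReal_coe, dimToEReal_coe]
      exact_mod_cast WithBot.coe_le_coe.1 hab

/-- A nonempty family attains its infimum by well-foundedness; for the empty family both sides are
`⊤`. -/
theorem dimToEReal_iInf {ι : Sort*} (f : ι → WithBot ℕ∞) :
    dimToEReal (⨅ i, f i) = ⨅ i, dimToEReal (f i) := by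
  apply le_antisymm dimToEReal_mono.map_iInf_le
  cases isEmpty_or_nonempty ι
  · rw [iInf_of_empty, iInf_of_empty, dimToEReal_top]
  · obtain ⟨_, ⟨i, rfl⟩, hi⟩ := WellFounded.has_min (r := (· < ·)) wellFounded_lt (Set.range f)
      (Set.range_nonempty f)
    exact (iInf_le _ i).trans (dimToEReal_mono (le_iInf fun j ↦ not_lt.1 (hi _ ⟨j, rfl⟩)))

/-! ### Comparison of jet-codimension, Krull codimension and cylinders -/

section

variable {k R : Type*} [Field k] [CommRing R] [Algebra k R]

theorem closure_image_arcProj {C : Set (ArcSpace k R)} (hC : IsClosed C) (m : ℕ) :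
    closure (arcProj k R m '' C) =
      zeroLocus (((vanishingIdeal C).comap (JetAlgebra.trunc k R m) : Ideal _) : Set _) := by
  conv_lhs => rw [← hC.closure_eq, ← zeroLocus_vanishingIdeal_eq_closure C]
  exact closure_image_comap_zeroLocus (JetAlgebra.trunc k R m).toRingHom _

section

variable [Algebra.FiniteType k R] [Algebra.FormallySmooth k R]

/-- A cylinder contains every point with the same image in `X_m` as its generic point `p`. The
extension `q` of the contraction of `p` is such a point and lies below `p`, so `q = p`, which has
finite height. -/
theorem isCylinder_iff_height_ne_top {C : Set (ArcSpace k R)} (hC : IsClosed C)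
    (hC' : IsIrreducible C) : IsCylinder C ↔ (vanishingIdeal C).height ≠ ⊤ := by
  have hp := isIrreducible_iff_vanishingIdeal_isPrime.1 hC'
  have hz : C = zeroLocus (vanishingIdeal C) := by
    rw [zeroLocus_vanishingIdeal_eq_closure, hC.closure_eq]
  constructor
  · rintro ⟨m, S, -, hS⟩
    let p : ArcSpace k R := ⟨vanishingIdeal C, hp⟩
    obtain ⟨h1, h2⟩ := JetAlgebra.isPrime_map_trunc (arcProj k R m p).asIdeal
    let q : ArcSpace k R := ⟨(arcProj k R m p).asIdeal.map (JetAlgebra.trunc k R m), h1⟩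
    have hpC : p ∈ C := by rw [hz]; exact le_refl (vanishingIdeal C)
    have hqC : q ∈ C := by
      rw [hS] at hpC ⊢
      have : arcProj k R m q = arcProj k R m p := PrimeSpectrum.ext h2
      rwa [Set.mem_preimage, this]
    rw [hz] at hqC
    have hqp : q.asIdeal = vanishingIdeal C := le_antisymm Ideal.map_comap_le hqC
    rw [← hqp]
    exact JetAlgebra.height_map_trunc_ne_top _
  · intro h
    obtain ⟨m, hm⟩ := JetAlgebra.exists_map_comap_trunc_eq _ h
    refine ⟨m, zeroLocus ((vanishingIdeal C).comap (JetAlgebra.trunc k R m) : Ideal _), ?_, ?_⟩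
    · rw [← isConstructible_compl]
      exact (TopologicalSpace.NoetherianSpace.isCompact _).isConstructible
        (isClosed_zeroLocus _).isOpen_compl
    · conv_lhs => rw [hz, ← hm]
      rw [arcProj, preimage_comap_zeroLocus]
      exact zeroLocus_span _

end

variable [CharZero k] [IsDomain R] [Algebra.FiniteType k R] [Algebra.FormallySmooth k R]

theorem jetCodimSeq_eq_height {C : Set (ArcSpace k R)} (hC : IsClosed C) (hC' : IsIrreducible C)
    (m : ℕ) : jetCodimSeq C m =
      ((((vanishingIdeal C).comap (JetAlgebra.trunc k R m)).height : ENNReal) : EReal) := by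
  have := isIrreducible_iff_vanishingIdeal_isPrime.1 hC'
  obtain ⟨n, -, -, hn⟩ := exists_isTranscendenceBasis_fin k R
  have h1 := height_add_ringKrullDim_quotient k
    ((vanishingIdeal C).comap (JetAlgebra.trunc k R m))
  rw [JetAlgebra.ringKrullDim_eq hn] at h1
  rw [jetCodimSeq, closure_image_arcProj hC, topologicalKrullDim_zeroLocus, hn]
  generalize ringKrullDim
    (JetAlgebra k R m ⧸ (vanishingIdeal C).comap (JetAlgebra.trunc k R m)) = b at h1 ⊢
  generalize ((vanishingIdeal C).comap (JetAlgebra.trunc k R m)).height = a at h1 ⊢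
  induction b with
  | bot => exact absurd (h1.symm.trans (WithBot.add_bot _)) (WithBot.natCast_ne_bot _)
  | coe b =>
    have h2 : a + b = ((m + 1) * n : ℕ) := by exact_mod_cast h1
    -- Both summands are finite because their sum is, so the subtraction in `EReal` is one of real
    -- numbers.
    have ha : a ≠ ⊤ := by
      rintro rfl
      exact ENat.natCast_ne_top _ (h2.symm.trans (top_add b))
    have hb : b ≠ ⊤ := by
      rintro rfl
      exact ENat.natCast_ne_top _ (h2.symm.trans (add_top a))
    lift a to ℕ using ha
    lift b to ℕ using hb
    have h3 : a + b = (m + 1) * n := by exact_mod_cast h2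
    have h4 : (a : ℝ) = ((m + 1 : ℕ) : ℝ) * n - b := by
      rw [eq_sub_iff_add_eq]; exact_mod_cast h3
    refine (congrArg₂ _ (congrArg _ (dimToEReal_natCast n)) (dimToEReal_natCast b)).trans
      (Eq.trans ?_ (dimToEReal_natCast a).symm)
    rw [h4, EReal.coe_sub, EReal.coe_mul]
    rfl

/-- The terms are an increasing sequence of heights, which converges to its supremum, the height of
the full prime. -/
theorem tendsto_jetCodimSeq {C : Set (ArcSpace k R)} (hC : IsClosed C) (hC' : IsIrreducible C) :
    Tendsto (jetCodimSeq C) atTop (𝓝 (dimToEReal (vanishingIdeal C).height)) := by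
  have := isIrreducible_iff_vanishingIdeal_isPrime.1 hC'
  have h1 := tendsto_atTop_iSup (JetAlgebra.height_comap_trunc_mono (vanishingIdeal C))
  rw [← JetAlgebra.height_eq_iSup] at h1
  rw [funext (jetCodimSeq_eq_height hC hC'), dimToEReal_coe]
  exact ((continuous_coe_ennreal_ereal.comp ENat.continuous_toENNReal).tendsto _).comp h1

theorem jetCodimIrred_eq_krullCodimIrred {C : Set (ArcSpace k R)} (hC : IsClosed C)
    (hC' : IsIrreducible C) : jetCodimIrred C = dimToEReal (krullCodimIrred C hC') := by
  rw [krullCodimIrred_eq_height]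
  exact (tendsto_jetCodimSeq hC hC').limUnder_eq

theorem jetCodim_eq_krullCodim (C : Set (ArcSpace k R)) :
    jetCodim C = dimToEReal (krullCodim C) := by
  simp only [jetCodim, krullCodim, dimToEReal_iInf]
  exact iInf_congr fun Z ↦ iInf_congr fun hZ ↦
    jetCodimIrred_eq_krullCodimIrred (isClosed_of_mem_irredComponentsOf isClosed_closure hZ) hZ.1.1

end

end

theorem proposition4p13 {k R : Type*} [Field k] [IsAlgClosed k] [CharZero k]
    [CommRing R] [IsDomain R] [Algebra k R] [Algebra.FiniteType k R] [Algebra.Smooth k R] :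
    (∀ C : Set (ArcSpace k R), jetCodim C = dimToEReal (krullCodim C)) ∧
    (∀ C : Set (ArcSpace k R), IsClosed C → IsIrreducible C →
      Filter.Tendsto (jetCodimSeq C) Filter.atTop (𝓝 (jetCodim C)) ∧
      ((∃ d : ℕ, krullCodim C = d) ↔ IsCylinder C)) := by
  refine ⟨jetCodim_eq_krullCodim, fun C hC hC' ↦ ?_⟩
  rw [jetCodim_eq_krullCodim, krullCodim_of_isIrreducible hC hC',
    isCylinder_iff_height_ne_top hC hC', ENat.ne_top_iff_exists]
  refine ⟨tendsto_jetCodimSeq hC hC', exists_congr fun d ↦ ?_⟩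
  rw [eq_comm]
  exact WithBot.coe_inj (a := (d : ℕ∞))
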